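/- An EMV-algebra is an algebra $(M;\vee,\wedge,\oplus,0)$ such that $(M;\vee,\wedge,0)$ is a distributive lattice with least element $0$; $(M;\oplus,0)$ is a commutative monoid whose addition is monotone ($x\le y$ implies $x\oplus z\le y\oplus z$); for every idempotent $a$ (that is, $a\oplus a=a$) the interval $[0,a]$ is an MV-algebra $([0,a];\oplus,\lambda_a,0,a)$, where $\lambda_a(x)=\min\{z\in[0,a] : z\oplus x=a\}$; and every element of $M$ lies below an idempotent. The set $\mathcal I(M)$ of idempotents is an EMV-algebra under the restricted operations. An ideal is a nonempty down-closed subset closed under $\oplus$, and a maximal ideal is a maximal proper ideal. The set $\mathrm{MaxI}(M)$ of maximal ideals carries the hull-kernel topology, whose open sets are $\{A\in\mathrm{MaxI}(M) : A\not\supseteq I\}$ for $I$ an ideal of $M$. A state-morphism on $M$ is a map $s:M\to[0,1]$ with $s(x)=1$ for some $x\in M$ that is an EMV-homomorphism, i.e. preserves $\vee,\wedge,\oplus,0$ and satisfies $s(\lambda_b(x))=\lambda_{s(b)}(s(x))$ for every idempotent $b$ and $x\le b$; here $[0,1]$ is the EMV-algebra with the usual order and $x\oplus y=\min\{x+y,1\}$.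 The set $\mathcal{SM}(M)$ of state-morphisms carries the subspace topology of the product topology of $[0,1]^M$. The algebra $M$ has the general comparability property if for every idempotent $a$ and all $x,y\in[0,a]$ there is an idempotent $e\in[0,a]$ with $x\wedge e\le y$ and $y\wedge\lambda_a(e)\le x$. **Theorem.** Let $M$ be an EMV-algebra with the general comparability property. Then the map $\xi:\mathrm{MaxI}(M)\to\mathrm{MaxI}(\mathcal I(M))$, $\xi(A)=A\cap\mathcal I(M)$, is (well defined and) a homeomorphism. Moreover, the spaces $\mathcal{SM}(M)$, $\mathcal{SM}(\mathcal I(M))$, $\mathrm{MaxI}(M)$ and $\mathrm{MaxI}(\mathcal I(M))$ are mutually homeomorphic, and each of them is compact if and only if $M$ has a top element. -/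

import Mathlib

/-- The axioms of an MV-algebra for given operations `⊕`, `*`, `0`, `1` on a type. -/
structure IsMVAlgebra {A : Type*} (add : A → A → A) (neg : A → A) (zero one : A) : Prop where
  add_assoc : ∀ x y z, add (add x y) z = add x (add y z)
  add_comm : ∀ x y, add x y = add y x
  add_zero : ∀ x, add x zero = x
  neg_neg : ∀ x, neg (neg x) = x
  add_one : ∀ x, add x one = one
  add_neg_add_neg : ∀ x y, add x (neg (add x (neg y))) = add y (neg (add y (neg x)))

/-- An EMV-algebra: a distributive lattice with least element `⊥` (the element `0`), together with
a commutative monoid operation `⊕` that is monotone and has `⊥` as its neutral element, such that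
every interval `[0, a]` below an idempotent `a` is closed under `⊕` and is an MV-algebra under `⊕`
and the relative negation `x ↦ min {z ∈ [0, a] | z ⊕ x = a}` (in particular these minima exist),
and such that every element lies below an idempotent. -/
class EMVAlgebra (M : Type*) [DistribLattice M] [OrderBot M] where
  oplus : M → M → M
  oplus_assoc : ∀ x y z, oplus (oplus x y) z = oplus x (oplus y z)
  oplus_comm : ∀ x y, oplus x y = oplus y x
  oplus_bot : ∀ x, oplus x ⊥ = x
  oplus_le_oplus : ∀ x y z, x ≤ y → oplus x z ≤ oplus y z
  isMVAlgebra_Iic : ∀ a, oplus a a = a →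
    ∃ (add : Set.Iic a → Set.Iic a → Set.Iic a) (neg : Set.Iic a → Set.Iic a),
      (∀ x y : Set.Iic a, (add x y : M) = oplus x y) ∧
      (∀ x : Set.Iic a, IsLeast {z : M | z ≤ a ∧ oplus z x = a} (neg x)) ∧
      IsMVAlgebra add neg ⟨⊥, bot_le⟩ ⟨a, le_rfl⟩
  exists_idempotent_ge : ∀ x, ∃ a, oplus a a = a ∧ x ≤ a

namespace EMVAlgebra

section Basic

variable {M : Type*} [DistribLattice M] [OrderBot M] [EMVAlgebra M]

/-- An element `a` with `a ⊕ a = a`. -/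
def IsIdem (a : M) : Prop := oplus a a = a

open Classical in
/-- `lam a x` is the relative negation `min {z ∈ [0, a] | z ⊕ x = a}`; it is used only for an
idempotent `a` and `x ≤ a`, where the minimum exists (see `isLeast_lam`). -/
noncomputable def lam (a x : M) : M :=
  if h : ∃ z, IsLeast {z : M | z ≤ a ∧ oplus z x = a} z then h.choose else ⊥

theorem isLeast_lam {a x : M} (ha : IsIdem a) (hx : x ≤ a) :
    IsLeast {z : M | z ≤ a ∧ oplus z x = a} (lam a x) := by
  have h : ∃ z, IsLeast {z : M | z ≤ a ∧ oplus z x = a} z := by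
    obtain ⟨add, neg, _, h2, _⟩ := isMVAlgebra_Iic a ha
    exact ⟨_, h2 ⟨x, hx⟩⟩
  rw [lam, dif_pos h]
  exact h.choose_spec

theorem lam_le {a x : M} (ha : IsIdem a) (hx : x ≤ a) : lam a x ≤ a := (isLeast_lam ha hx).1.1

theorem lam_oplus {a x : M} (ha : IsIdem a) (hx : x ≤ a) : oplus (lam a x) x = a :=
  (isLeast_lam ha hx).1.2

theorem lam_le_of {a x z : M} (ha : IsIdem a) (hx : x ≤ a) (hz : z ≤ a) (h : oplus z x = a) :
    lam a x ≤ z := (isLeast_lam ha hx).2 ⟨hz, h⟩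

theorem oplus_mono {x y z w : M} (h : x ≤ y) (h' : z ≤ w) : oplus x z ≤ oplus y w := by
  refine (oplus_le_oplus x y z h).trans ?_
  rw [oplus_comm y z, oplus_comm y w]
  exact oplus_le_oplus z w y h'

theorem le_oplus_left (x y : M) : x ≤ oplus x y := by
  have h := oplus_mono (le_refl x) (bot_le : ⊥ ≤ y)
  rwa [oplus_bot] at h

theorem le_oplus_right (x y : M) : y ≤ oplus x y := by
  rw [oplus_comm]
  exact le_oplus_left y x

theorem oplus_le_idem {a x y : M} (ha : IsIdem a) (hx : x ≤ a) (hy : y ≤ a) : oplus x y ≤ a :=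
  (oplus_mono hx hy).trans ha.le

theorem lam_lam {a x : M} (ha : IsIdem a) (hx : x ≤ a) : lam a (lam a x) = x := by
  obtain ⟨add, neg, _, h2, h3⟩ := isMVAlgebra_Iic a ha
  have e1 : ∀ y : Set.Iic a, lam a (y : M) = neg y := fun y =>
    (isLeast_lam ha y.2).unique (h2 y)
  have := e1 ⟨x, hx⟩
  rw [this, e1, h3.neg_neg]

theorem lam_self {a : M} (ha : IsIdem a) : lam a a = ⊥ :=
  le_bot_iff.1 (lam_le_of ha le_rfl bot_le (by rw [oplus_comm, oplus_bot]))

theorem oplus_lam_oplus_lam {a x y : M} (ha : IsIdem a) (hx : x ≤ a) (hy : y ≤ a) :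
    oplus x (lam a (oplus x (lam a y))) = oplus y (lam a (oplus y (lam a x))) := by
  obtain ⟨add, neg, h1, h2, h3⟩ := isMVAlgebra_Iic a ha
  have e1 : ∀ y : Set.Iic a, (neg y : M) = lam a (y : M) := fun y =>
    (h2 y).unique (isLeast_lam ha y.2)
  have := congrArg Subtype.val (h3.add_neg_add_neg ⟨x, hx⟩ ⟨y, hy⟩)
  simpa only [h1, e1] using this

theorem eq_oplus_of_le {a x y : M} (ha : IsIdem a) (hxy : x ≤ y) (hy : y ≤ a) :
    oplus x (lam a (oplus x (lam a y))) = y := by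
  have hx := hxy.trans hy
  have h : oplus y (lam a x) = a := by
    refine le_antisymm (oplus_le_idem ha hy (lam_le ha hx)) ?_
    conv_lhs => rw [← lam_oplus ha hx, oplus_comm]
    exact oplus_mono hxy le_rfl
  rw [oplus_lam_oplus_lam ha hx hy, h, lam_self ha, oplus_bot]

theorem idem_oplus {a x : M} (ha : IsIdem a) : oplus a x = a ⊔ x := by
  refine le_antisymm ?_ (sup_le (le_oplus_left a x) (le_oplus_right a x))
  obtain ⟨c, hc, hcu⟩ := exists_idempotent_ge (a ⊔ x)
  have h := eq_oplus_of_le hc (le_sup_left : a ≤ a ⊔ x) hcu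
  have h2 : oplus a (a ⊔ x) = a ⊔ x := by
    conv_lhs => rw [← h, ← oplus_assoc, show oplus a a = a from ha]
    exact h
  calc oplus a x ≤ oplus a (a ⊔ x) := oplus_mono le_rfl le_sup_right
    _ = a ⊔ x := h2

theorem IsIdem.oplus {a b : M} (ha : IsIdem a) (hb : IsIdem b) : IsIdem (oplus a b) := by
  unfold IsIdem at *
  rw [oplus_assoc, ← oplus_assoc b a b, oplus_comm b a, oplus_assoc a b b, hb, ← oplus_assoc, ha]

theorem IsIdem.sup {a b : M} (ha : IsIdem a) (hb : IsIdem b) : IsIdem (a ⊔ b) := by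
  rw [← idem_oplus ha]
  exact ha.oplus hb

theorem IsIdem.inf {a b : M} (ha : IsIdem a) (hb : IsIdem b) : IsIdem (a ⊓ b) :=
  le_antisymm (le_inf (oplus_le_idem ha inf_le_left inf_le_left)
    (oplus_le_idem hb inf_le_right inf_le_right)) (le_oplus_left _ _)

theorem isIdem_bot : IsIdem (⊥ : M) := oplus_bot ⊥

theorem IsIdem.lam {a x : M} (ha : IsIdem a) (hxi : IsIdem x) (hx : x ≤ a) :
    IsIdem (lam a x) := by
  set y := EMVAlgebra.lam a x with hy
  have hya : y ≤ a := lam_le ha hx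
  have hz : EMVAlgebra.oplus y y ≤ a := oplus_le_idem ha hya hya
  set w := EMVAlgebra.lam a (EMVAlgebra.oplus y y) with hw
  have hwa : w ≤ a := lam_le ha hz
  have h1 : EMVAlgebra.oplus (EMVAlgebra.oplus w y) y = a := by
    rw [oplus_assoc]
    exact lam_oplus ha hz
  have hwy : EMVAlgebra.oplus w y ≤ a := oplus_le_idem ha hwa hya
  have h2 : x ≤ EMVAlgebra.oplus w y := by
    have := lam_le_of ha hya hwy h1
    rwa [hy, lam_lam ha hx] at this
  have h3 : EMVAlgebra.oplus w y = a := by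
    refine le_antisymm hwy ?_
    have := sup_le h2 (le_oplus_right w y)
    rw [← idem_oplus hxi, oplus_comm x y, hy, lam_oplus ha hx, ← hy] at this
    exact this
  have h4 : x ≤ w := by
    have := lam_le_of ha hya hwa h3
    rwa [hy, lam_lam ha hx] at this
  have h5 : w ≤ x := lam_le_of ha hz hx (by
    refine le_antisymm (oplus_le_idem ha hx hz) ?_
    conv_lhs => rw [← lam_oplus ha hx, oplus_comm, ← hy]
    exact oplus_mono le_rfl (le_oplus_left _ _))
  have h6 : w = x := le_antisymm h5 h4
  have h7 := lam_lam ha hz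
  rw [← hw, h6, ← hy] at h7
  exact h7.symm

theorem inf_oplus_le (y u v : M) : y ⊓ oplus u v ≤ oplus (y ⊓ u) (y ⊓ v) := by
  have key : ∀ t p q r : M, t ≤ oplus p q → t ≤ oplus p r → t ≤ oplus p (q ⊓ r) := by
    intro t p q r hq hr
    obtain ⟨c, hc, hcu⟩ := exists_idempotent_ge (t ⊔ p ⊔ q ⊔ r)
    have htc : t ≤ c := le_trans (by simp [sup_assoc]) hcu
    have hpc : p ≤ c :=
      (le_sup_right.trans le_sup_left : p ≤ t ⊔ p ⊔ q).trans (le_sup_left.trans hcu)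
    have hqc : q ≤ c := (le_sup_right : q ≤ t ⊔ p ⊔ q).trans (le_sup_left.trans hcu)
    have hrc : r ≤ c := le_sup_right.trans hcu
    have hpt : oplus p (lam c t) ≤ c := oplus_le_idem hc hpc (lam_le hc htc)
    have res : ∀ q : M, q ≤ c → t ≤ oplus p q → lam c (oplus p (lam c t)) ≤ q := by
      intro q hqc hq
      refine lam_le_of hc hpt hqc (le_antisymm (oplus_le_idem hc hqc hpt) ?_)
      rw [← oplus_assoc, oplus_comm q p]
      conv_lhs => rw [← lam_oplus hc htc, oplus_comm]
      exact oplus_mono hq le_rfl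
    have h := le_inf (res q hqc hq) (res r hrc hr)
    calc t ≤ oplus t (lam c (oplus t (lam c p))) := le_oplus_left _ _
      _ = oplus p (lam c (oplus p (lam c t))) := oplus_lam_oplus_lam hc htc hpc
      _ ≤ _ := oplus_mono le_rfl h
  refine key _ _ _ _ (inf_le_left.trans (le_oplus_right _ _)) ?_
  have h := key (y ⊓ oplus u v) v y u (inf_le_left.trans (le_oplus_right _ _))
    (inf_le_right.trans (oplus_comm u v).le)
  rwa [oplus_comm v] at h

end Basic

/-! ### The subalgebra of idempotents -/

/-- The set of idempotents of `M`, as a type. -/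
def Idem (M : Type*) [DistribLattice M] [OrderBot M] [EMVAlgebra M] : Type _ :=
  {a : M // IsIdem a}

section IdemInstances

variable {M : Type*} [DistribLattice M] [OrderBot M] [EMVAlgebra M]

instance : DistribLattice (Idem M) :=
  Subtype.distribLattice (P := fun a : M => IsIdem a) (fun _ _ => IsIdem.sup)
    (fun _ _ => IsIdem.inf)

instance : OrderBot (Idem M) where
  bot := ⟨⊥, isIdem_bot⟩
  bot_le x := (bot_le : (⊥ : M) ≤ x.1)

/-- The idempotents of an EMV-algebra form an EMV-algebra under the restricted operations. -/
instance : EMVAlgebra (Idem M) where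
  oplus a b := ⟨oplus a.1 b.1, a.2.oplus b.2⟩
  oplus_assoc x y z := Subtype.ext (oplus_assoc x.1 y.1 z.1)
  oplus_comm x y := Subtype.ext (oplus_comm x.1 y.1)
  oplus_bot x := Subtype.ext (oplus_bot x.1)
  oplus_le_oplus x y z h := oplus_le_oplus x.1 y.1 z.1 h
  isMVAlgebra_Iic a _ := by
    have hle : ∀ x : Set.Iic a, x.1.1 ≤ a.1 := fun x => x.2
    refine ⟨fun x y => ⟨⟨oplus x.1.1 y.1.1, x.1.2.oplus y.1.2⟩,
        oplus_le_idem a.2 (hle x) (hle y)⟩,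
      fun x => ⟨⟨lam a.1 x.1.1, a.2.lam x.1.2 (hle x)⟩, lam_le a.2 (hle x)⟩,
      fun _ _ => rfl, fun x : Set.Iic a => ⟨⟨lam_le a.2 (hle x), Subtype.ext (lam_oplus a.2 (hle x))⟩,
        fun z hz => lam_le_of a.2 (hle x) hz.1 (congrArg Subtype.val hz.2)⟩, ?_⟩
    constructor
    · exact fun x y z => Subtype.ext (Subtype.ext (oplus_assoc _ _ _))
    · exact fun x y => Subtype.ext (Subtype.ext (oplus_comm _ _))
    · exact fun x => Subtype.ext (Subtype.ext (oplus_bot _))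
    · exact fun x => Subtype.ext (Subtype.ext (lam_lam a.2 (hle x)))
    · exact fun x => Subtype.ext (Subtype.ext
        (le_antisymm (oplus_le_idem a.2 (hle x) le_rfl) (le_oplus_right _ _)))
    · exact fun x y => Subtype.ext (Subtype.ext (oplus_lam_oplus_lam a.2 (hle x) (hle y)))
  exists_idempotent_ge x := ⟨x, Subtype.ext x.2, le_rfl⟩

end IdemInstances

/-! ### The real unit interval -/

/-- The real interval `[0, 1]` with `x ⊕ y = min (x + y) 1`. -/
noncomputable instance : EMVAlgebra unitInterval where
  oplus x y := ⟨min (x.1 + y.1) 1, le_min (add_nonneg x.2.1 y.2.1) zero_le_one, min_le_right _ _⟩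
  oplus_assoc x y z := by
    obtain ⟨x, hx0, hx1⟩ := x
    obtain ⟨y, hy0, hy1⟩ := y
    obtain ⟨z, hz0, hz1⟩ := z
    apply Subtype.ext
    simp only
    grind
  oplus_comm x y := by
    apply Subtype.ext
    simp only [add_comm]
  oplus_bot x := by
    apply Subtype.ext
    change min (x.1 + 0) 1 = x.1
    rw [add_zero, min_eq_left x.2.2]
  oplus_le_oplus x y z h := by
    have h' : x.1 ≤ y.1 := h
    change min (x.1 + z.1) 1 ≤ min (y.1 + z.1) 1
    gcongr
  isMVAlgebra_Iic a ha := by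
    have ha' : min (a.1 + a.1) 1 = a.1 := congrArg Subtype.val ha
    have ha0 := a.2.1
    have ha1 := a.2.2
    have h01 : a.1 = 0 ∨ a.1 = 1 := by grind
    have hle : ∀ x : Set.Iic a, x.1.1 ≤ a.1 := fun x => x.2
    have h0 : ∀ x : Set.Iic a, 0 ≤ x.1.1 := fun x => x.1.2.1
    refine ⟨fun x y => ⟨⟨min (x.1.1 + y.1.1) 1,
          le_min (add_nonneg (h0 x) (h0 y)) zero_le_one, min_le_right _ _⟩, ?_⟩,
      fun x => ⟨⟨(a.1 : ℝ) - x.1.1, sub_nonneg.2 (hle x), by linarith [h0 x]⟩, ?_⟩,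
      fun _ _ => rfl, fun x : Set.Iic a => ⟨⟨?_, ?_⟩, ?_⟩, ?_⟩
    · change min (x.1.1 + y.1.1) 1 ≤ a.1
      have := hle x
      have := hle y
      grind
    · change (a.1 : ℝ) - x.1.1 ≤ a.1
      linarith [h0 x]
    · change (a.1 : ℝ) - x.1.1 ≤ a.1
      linarith [h0 x]
    · apply Subtype.ext
      change min ((a.1 : ℝ) - x.1.1 + x.1.1) 1 = a.1
      rw [sub_add_cancel, min_eq_left ha1]
    · intro z hz
      have hz2 : min (z.1 + x.1.1) 1 = a.1 := congrArg Subtype.val hz.2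
      change (a.1 : ℝ) - x.1.1 ≤ z.1
      have := hle x
      grind
    · constructor
      · intro x y z
        have hx := h0 x
        have hy := h0 y
        have hz := h0 z
        apply Subtype.ext
        apply Subtype.ext
        simp only
        grind
      · intro x y
        apply Subtype.ext
        apply Subtype.ext
        simp only [add_comm]
      · intro x
        apply Subtype.ext
        apply Subtype.ext
        change min (x.1.1 + 0) 1 = x.1.1
        rw [add_zero, min_eq_left x.1.2.2]
      · intro x
        apply Subtype.ext
        apply Subtype.ext
        simp only [sub_sub_cancel]
      · intro x
        have hx := h0 x
        have hxa := hle x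
        apply Subtype.ext
        apply Subtype.ext
        simp only
        grind
      · intro x y
        have hx := h0 x
        have hy := h0 y
        have hxa := hle x
        have hya := hle y
        apply Subtype.ext
        apply Subtype.ext
        simp only
        grind
  exists_idempotent_ge x := by
    refine ⟨1, ?_, x.2.2⟩
    apply Subtype.ext
    change min ((1 : ℝ) + 1) 1 = 1
    norm_num

/-! ### Ideals and maximal ideals -/

section Ideals

variable {M : Type*} [DistribLattice M] [OrderBot M] [EMVAlgebra M]

/-- A nonempty down-closed subset closed under `⊕`. -/
structure IsIdeal (I : Set M) : Prop where
  nonempty : I.Nonempty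
  mem_of_le : ∀ x y, x ≤ y → y ∈ I → x ∈ I
  oplus_mem : ∀ x y, x ∈ I → y ∈ I → oplus x y ∈ I

/-- A proper ideal that is not properly contained in another proper ideal. -/
structure IsMaximalIdeal (A : Set M) : Prop where
  isIdeal : IsIdeal A
  ne_univ : A ≠ Set.univ
  eq_of_subset : ∀ J : Set M, IsIdeal J → J ≠ Set.univ → A ⊆ J → J = A

theorem IsIdeal.inter {I J : Set M} (hI : IsIdeal I) (hJ : IsIdeal J) : IsIdeal (I ∩ J) := by
  obtain ⟨x, hx⟩ := hI.nonempty
  obtain ⟨y, hy⟩ := hJ.nonempty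
  exact ⟨⟨⊥, hI.mem_of_le _ _ bot_le hx, hJ.mem_of_le _ _ bot_le hy⟩,
    fun x y h hy => ⟨hI.mem_of_le x y h hy.1, hJ.mem_of_le x y h hy.2⟩,
    fun x y hx hy => ⟨hI.oplus_mem x y hx.1 hy.1, hJ.oplus_mem x y hx.2 hy.2⟩⟩

/-- Maximal ideals are prime. -/
theorem IsMaximalIdeal.mem_or_mem {A : Set M} (hA : IsMaximalIdeal A) {x y : M}
    (h : x ⊓ y ∈ A) : x ∈ A ∨ y ∈ A := by
  by_contra hcon
  obtain ⟨hx, hy⟩ := not_or.1 hcon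
  have hJ : IsIdeal {z : M | z ⊓ y ∈ A} := by
    refine ⟨⟨x, h⟩, fun u v huv hv => hA.isIdeal.mem_of_le _ _ (inf_le_inf_right y huv) hv,
      fun u v hu hv => ?_⟩
    have hu' : y ⊓ u ∈ A := by rwa [inf_comm]
    have hv' : y ⊓ v ∈ A := by rwa [inf_comm]
    have := hA.isIdeal.mem_of_le _ _ (inf_oplus_le y u v) (hA.isIdeal.oplus_mem _ _ hu' hv')
    rwa [inf_comm] at this
  have hne : {z : M | z ⊓ y ∈ A} ≠ Set.univ := by
    intro he
    have : y ∈ {z : M | z ⊓ y ∈ A} := he ▸ Set.mem_univ y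
    exact hy (by simpa using this)
  have hsub : A ⊆ {z : M | z ⊓ y ∈ A} := fun z hz => hA.isIdeal.mem_of_le _ _ inf_le_left hz
  have := hA.eq_of_subset _ hJ hne hsub
  exact hx (this ▸ h)

end Ideals

/-- The set of maximal ideals of `M`, as a type. -/
def MaxI (M : Type*) [DistribLattice M] [OrderBot M] [EMVAlgebra M] : Type _ :=
  {A : Set M // IsMaximalIdeal A}

/-- The hull-kernel topology: the open sets are the sets `{A | ¬ I ⊆ A}`, `I` an ideal of `M`. -/
instance (M : Type*) [DistribLattice M] [OrderBot M] [EMVAlgebra M] :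
    TopologicalSpace (MaxI M) where
  IsOpen U := ∃ I : Set M, IsIdeal I ∧ U = {A : MaxI M | ¬ I ⊆ A.1}
  isOpen_univ := ⟨Set.univ, ⟨⟨⊥, trivial⟩, fun _ _ _ _ => trivial, fun _ _ _ _ => trivial⟩, by
    ext A
    simpa using A.2.ne_univ⟩
  isOpen_inter := by
    rintro _ _ ⟨I, hI, rfl⟩ ⟨J, hJ, rfl⟩
    refine ⟨I ∩ J, hI.inter hJ, ?_⟩
    ext A
    constructor
    · rintro ⟨h1, h2⟩ h
      obtain ⟨x, hxI, hxA⟩ := Set.not_subset.1 h1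
      obtain ⟨y, hyJ, hyA⟩ := Set.not_subset.1 h2
      rcases A.2.mem_or_mem (h ⟨hI.mem_of_le _ _ inf_le_left hxI,
        hJ.mem_of_le _ _ inf_le_right hyJ⟩ : x ⊓ y ∈ A.1) with hx | hy
      · exact hxA hx
      · exact hyA hy
    · exact fun h => ⟨fun h' => h (Set.inter_subset_left.trans h'),
        fun h' => h (Set.inter_subset_right.trans h')⟩
  isOpen_sUnion := by
    intro S hS
    let K : Set M := ⋂₀ {J | IsIdeal J ∧ ∀ I : Set M, IsIdeal I →
      {A : MaxI M | ¬ I ⊆ A.1} ∈ S → I ⊆ J}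
    refine ⟨K, ⟨⟨⊥, ?_⟩, ?_, ?_⟩, ?_⟩
    · rintro J ⟨hJ, -⟩
      obtain ⟨x, hx⟩ := hJ.nonempty
      exact hJ.mem_of_le _ _ bot_le hx
    · exact fun x y h hy J hJ => hJ.1.mem_of_le x y h (hy J hJ)
    · exact fun x y hx hy J hJ => hJ.1.oplus_mem x y (hx J hJ) (hy J hJ)
    · ext A
      constructor
      · rintro ⟨U, hU, hAU⟩ hKA
        obtain ⟨I, hI, rfl⟩ := hS U hU
        have hIK : I ⊆ K := fun x hx J hJ => hJ.2 I hI hU hx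
        exact hAU (hIK.trans hKA)
      · intro hKA
        by_contra hcon
        refine hKA fun x hx => hx A.1 ⟨A.2.isIdeal, fun I hI hIS => ?_⟩
        by_contra hIA
        exact hcon ⟨_, hIS, hIA⟩

/-! ### State-morphisms -/

/-- EMV-homomorphisms. -/
structure IsEMVHom {M N : Type*} [DistribLattice M] [OrderBot M] [EMVAlgebra M]
    [DistribLattice N] [OrderBot N] [EMVAlgebra N] (f : M → N) : Prop where
  map_sup : ∀ x y, f (x ⊔ y) = f x ⊔ f y
  map_inf : ∀ x y, f (x ⊓ y) = f x ⊓ f y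
  map_oplus : ∀ x y, f (oplus x y) = oplus (f x) (f y)
  map_bot : f ⊥ = ⊥
  map_lam : ∀ b x, IsIdem b → x ≤ b → f (lam b x) = lam (f b) (f x)

/-- The set of state-morphisms of `M`: the EMV-homomorphisms into `[0, 1]` attaining `1`. -/
def StateMorphism (M : Type*) [DistribLattice M] [OrderBot M] [EMVAlgebra M] : Type _ :=
  {s : M → unitInterval // IsEMVHom s ∧ ∃ x, s x = 1}

/-- The weak topology: the subspace topology of the product topology on `[0, 1] ^ M`. -/
instance (M : Type*) [DistribLattice M] [OrderBot M] [EMVAlgebra M] :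
    TopologicalSpace (StateMorphism M) :=
  inferInstanceAs (TopologicalSpace {s : M → unitInterval // IsEMVHom s ∧ ∃ x, s x = 1})

/-- The general comparability property. -/
def GeneralComparability (M : Type*) [DistribLattice M] [OrderBot M] [EMVAlgebra M] : Prop :=
  ∀ a x y : M, IsIdem a → x ≤ a → y ≤ a →
    ∃ e, IsIdem e ∧ e ≤ a ∧ x ⊓ e ≤ y ∧ y ⊓ lam a e ≤ x

end EMVAlgebra

/-! Two correspondences carry the theorem. The first, valid for every EMV-algebra, is that a
state-morphism is determined by its kernel and that `ker` is a homeomorphism onto the maximal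
ideals. The second is that contraction to the idempotents is a homeomorphism under general
comparability. The remaining homeomorphisms are composites of these two.

For a maximal ideal `A` and an idempotent `b` outside it, primeness makes `[0, b]` modulo `A` a
nontrivial MV-chain. Such a chain has a state, obtained as a limit of dyadic approximations
(`exists_state_of_chain`), and `x ↦ s (x ⊓ b)` spreads it over the whole algebra. Its kernel is a
maximal ideal containing `A`, hence equals `A`. Injectivity of `ker` and continuity of its inverse
both come from `exists_separating`: doubling and its dual turn a strict inequality between values of
states into a statement about zeros.

For contraction, `exists_isMaximalIdeal` gives surjectivity. Injectivity and openness rest on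
`GeneralComparability.exists_idem`: an element outside a maximal ideal has a multiple above an
idempotent outside it, so idempotents already tell maximal ideals apart.

Compactness yields one idempotent lying in no maximal ideal, which must be the top; conversely, a
top element makes the state space closed in a cube. -/

namespace IsMVAlgebra

/-! ### Arithmetic of MV-algebras -/

section Arithmetic

variable {C : Type*} {add : C → C → C} {neg : C → C} {zero one : C}

theorem one_add (h : IsMVAlgebra add neg zero one) (x : C) : add one x = one := by
  rw [h.add_comm, h.add_one]

/-- The axioms as listed do not force `neg zero = one`: on a two-element chain, join with the
identity as negation satisfies them. Hence the separate assumption `h1` here and below. -/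
theorem neg_one (h : IsMVAlgebra add neg zero one) (h1 : neg zero = one) : neg one = zero := by
  rw [← h1, h.neg_neg]

theorem add_neg_self (h : IsMVAlgebra add neg zero one) (h1 : neg zero = one) (x : C) :
    add x (neg x) = one := by
  have := h.add_neg_add_neg x one
  rwa [h.neg_one h1, h.add_zero, h.one_add] at this

theorem neg_add_self (h : IsMVAlgebra add neg zero one) (h1 : neg zero = one) (x : C) :
    add (neg x) x = one := by
  rw [h.add_comm, h.add_neg_self h1]

/-- The order `x ≤ y` is encoded as `add (neg x) y = one`. The axiom `add_neg_add_neg` says that the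
join is symmetric, and here the join is `y`. -/
theorem add_sub_of_le (h : IsMVAlgebra add neg zero one) (h1 : neg zero = one) {x y : C}
    (hxy : add (neg x) y = one) : add x (neg (add x (neg y))) = y := by
  rw [h.add_neg_add_neg, h.add_comm y (neg x), hxy, h.neg_one h1, h.add_zero]

theorem add_right_mono (h : IsMVAlgebra add neg zero one) (h1 : neg zero = one) {x y : C}
    (hxy : add (neg x) y = one) (z : C) : add (neg (add x z)) (add y z) = one := by
  conv_lhs => rw [← h.add_sub_of_le h1 hxy, h.add_assoc x, h.add_comm (neg (add x (neg y))) z,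
    ← h.add_assoc x, ← h.add_assoc, h.neg_add_self h1, h.one_add]

theorem le_trans (h : IsMVAlgebra add neg zero one) (h1 : neg zero = one) {x y z : C}
    (hxy : add (neg x) y = one) (hyz : add (neg y) z = one) : add (neg x) z = one := by
  rw [← h.add_sub_of_le h1 hyz, ← h.add_assoc, hxy, h.one_add]

variable (add neg) in
/-- The Łukasiewicz conjunction of an MV-algebra. -/
def mul (x y : C) : C := neg (add (neg x) (neg y))

theorem mul_comm (h : IsMVAlgebra add neg zero one) (x y : C) :
    mul add neg x y = mul add neg y x := by
  rw [mul, mul, h.add_comm]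

theorem mul_eq_zero_iff (h : IsMVAlgebra add neg zero one) (h1 : neg zero = one) {x y : C} :
    mul add neg x y = zero ↔ add (neg x) (neg y) = one := by
  rw [mul]
  constructor
  · intro hx
    rw [← h1, ← hx, h.neg_neg]
  · intro hx
    rw [hx, h.neg_one h1]

theorem neg_add_add_of_mul_eq_zero (h : IsMVAlgebra add neg zero one) (h1 : neg zero = one)
    {b c : C} (hbc : mul add neg b c = zero) : add b (neg (add b c)) = neg c := by
  have := h.add_sub_of_le h1 ((h.mul_eq_zero_iff h1).1 hbc)
  rwa [h.neg_neg] at this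

/-- Both sides stand for `a + b + c - 1` cut off at `0`. Expanding `neg c` and `neg a` through the
disjoint sums turns each side into the negation of `neg (add a b) ⊕ b ⊕ neg (add b c)`. -/
theorem add_mul_assoc (h : IsMVAlgebra add neg zero one) (h1 : neg zero = one) {a b c : C}
    (hab : mul add neg a b = zero) (hbc : mul add neg b c = zero) :
    mul add neg (add a b) c = mul add neg a (add b c) := by
  rw [h.mul_comm] at hab
  rw [mul, mul, ← h.neg_add_add_of_mul_eq_zero h1 hbc, ← h.neg_add_add_of_mul_eq_zero h1 hab,
    h.add_comm b a, ← h.add_assoc, h.add_comm b (neg (add a b))]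

/-- Here `a + b + c - 1` needs no cut-off. With `u` the left side, `u ≤ c` and `a ⊕ b = neg c ⊕ u`,
so multiplying by `c` gives the meet of `u` and `c`, which is `u`. -/
theorem add_mul_eq_mul_add (h : IsMVAlgebra add neg zero one) (h1 : neg zero = one) {a b c : C}
    (hab : mul add neg a b = zero) (hbc : add b c = one) :
    add a (mul add neg b c) = mul add neg (add a b) c := by
  have hb : add (neg c) (mul add neg b c) = b := by
    rw [mul, h.add_comm (neg b)]
    exact h.add_sub_of_le h1 (by rw [h.neg_neg, h.add_comm, hbc])
  have hc : add (neg b) (mul add neg b c) = c :=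
    h.add_sub_of_le h1 (by rw [h.neg_neg, hbc])
  have hu : add (neg (add a (mul add neg b c))) c = one := by
    have := h.add_right_mono h1 ((h.mul_eq_zero_iff h1).1 hab) (mul add neg b c)
    rwa [hc] at this
  have h2 : add a b = add (neg c) (add a (mul add neg b c)) := by
    conv_lhs => rw [← hb, ← h.add_assoc, h.add_comm a, h.add_assoc]
  set u := add a (mul add neg b c)
  have h3 := h.add_neg_add_neg (neg c) (neg u)
  rw [h.neg_neg, h.neg_neg, hu, h.neg_one h1, h.add_zero] at h3
  rw [mul, h2, h.add_comm _ (neg c), h3, h.neg_neg]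

/-- Both sides stand for `2x + 2y - 1`. The chain condition on `y` and `x ⊕ y` decides which of the
two mixed associativity laws applies. -/
theorem mul_self_add (h : IsMVAlgebra add neg zero one) (h1 : neg zero = one)
    (hc : ∀ x y, mul add neg x y = zero ∨ add x y = one) {x y : C}
    (hxy : mul add neg x y = zero) (hx : mul add neg x x = zero) (hy : mul add neg y y = zero) :
    mul add neg (add x y) (add x y) = mul add neg (add x x) (add y y) := by
  have h2 : mul add neg y (add x y) = mul add neg x (add y y) := by
    rw [h.mul_comm, h.add_mul_assoc h1 hxy hy]
  have h3 : add y (add x y) = add x (add y y) := by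
    rw [h.add_comm y, h.add_assoc]
  rcases hc y (add x y) with h0 | h0
  · rw [h.add_mul_assoc h1 hxy h0, h3, ← h.add_mul_assoc h1 hx (h2 ▸ h0)]
  · rw [← h.add_mul_eq_mul_add h1 hxy h0, h2, h.add_mul_eq_mul_add h1 hx (h3 ▸ h0)]

theorem mul_self_add_of_add_self (h : IsMVAlgebra add neg zero one) (h1 : neg zero = one) {x y : C}
    (hxy : mul add neg x y = zero) (hx : add x x = one) :
    mul add neg (add x y) (add x y) = add (mul add neg x x) (add y y) := by
  rw [h.mul_comm] at hxy
  have h0 : add x (add y x) = one := by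
    rw [h.add_comm y, ← h.add_assoc, hx, h.one_add]
  rw [h.add_comm x y, ← h.add_mul_eq_mul_add h1 hxy h0, h.mul_comm x,
    ← h.add_mul_eq_mul_add h1 hxy hx, ← h.add_assoc, h.add_comm]

theorem neg_mul_self (h : IsMVAlgebra add neg zero one) (x : C) :
    neg (mul add neg x x) = add (neg x) (neg x) := by
  rw [mul, h.neg_neg]

theorem mul_neg_self (h : IsMVAlgebra add neg zero one) (x : C) :
    mul add neg (neg x) (neg x) = neg (add x x) := by
  rw [mul, h.neg_neg]

theorem mul_self_mul_add_self (h : IsMVAlgebra add neg zero one) (h1 : neg zero = one) {x y : C}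
    (hxy : mul add neg x y = zero) :
    mul add neg (mul add neg x x) (add y y) = zero := by
  rw [h.mul_comm, h.mul_eq_zero_iff h1, h.neg_mul_self]
  have h2 : add (neg y) (neg x) = one := by
    rw [h.add_comm]
    exact (h.mul_eq_zero_iff h1).1 hxy
  have h3 := h.add_right_mono h1 h2 (neg x)
  rw [h.add_comm y] at h3
  exact h.le_trans h1 (h.add_right_mono h1 h2 y) h3

/-- The chain of inequalities is `y ≤ neg x ≤ x ≤ neg y`. -/
theorem mul_self_of_add_self (h : IsMVAlgebra add neg zero one) (h1 : neg zero = one) {x y : C}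
    (hxy : mul add neg x y = zero) (hx : add x x = one) : mul add neg y y = zero := by
  rw [h.mul_eq_zero_iff h1] at hxy ⊢
  have h2 : add (neg y) (neg x) = one := by rw [h.add_comm, hxy]
  have h3 : add (neg (neg x)) x = one := by rw [h.neg_neg, hx]
  exact h.le_trans h1 h2 (h.le_trans h1 h3 hxy)

end Arithmetic

/-! ### The state of an MV-chain -/

section Chain

variable {C : Type*} (add : C → C → C) (neg : C → C) (one : C)

open Classical in
/-- Dyadic approximations, from below, of the state of an MV-chain: the `n`-th one is `2⁻ⁿ` times the
integer part of `2ⁿ x`. -/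
noncomputable def dyadicApprox : ℕ → C → ℝ
  | 0, x => if x = one then 1 else 0
  | n + 1, x => (dyadicApprox n (add x x) + dyadicApprox n (mul add neg x x)) / 2

variable {add neg one} {zero : C}

theorem mul_zero (h : IsMVAlgebra add neg zero one) (h1 : neg zero = one) (x : C) :
    mul add neg x zero = zero := by
  rw [mul, h1, h.add_one, h.neg_one h1]

theorem mul_one (h : IsMVAlgebra add neg zero one) (h1 : neg zero = one) (x : C) :
    mul add neg x one = x := by
  rw [mul, h.neg_one h1, h.add_zero, h.neg_neg]

theorem dyadicApprox_zero (h : IsMVAlgebra add neg zero one) (h1 : neg zero = one)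
    (hne : zero ≠ one) (n : ℕ) : dyadicApprox add neg one n zero = 0 := by
  induction n with
  | zero => simp [dyadicApprox, hne]
  | succ n ih => simp [dyadicApprox, h.add_zero, h.mul_zero h1, ih]

theorem dyadicApprox_one (h : IsMVAlgebra add neg zero one) (h1 : neg zero = one) (n : ℕ) :
    dyadicApprox add neg one n one = 1 := by
  induction n with
  | zero => simp [dyadicApprox]
  | succ n ih => simp [dyadicApprox, h.add_one, h.mul_one h1, ih]

theorem dyadicApprox_nonneg (n : ℕ) (x : C) : 0 ≤ dyadicApprox add neg one n x := by
  induction n generalizing x with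
  | zero => unfold dyadicApprox; positivity
  | succ n ih => rw [dyadicApprox]; linarith [ih (add x x), ih (mul add neg x x)]

theorem dyadicApprox_le_one (n : ℕ) (x : C) : dyadicApprox add neg one n x ≤ 1 := by
  induction n generalizing x with
  | zero => unfold dyadicApprox; split_ifs <;> simp
  | succ n ih => rw [dyadicApprox]; linarith [ih (add x x), ih (mul add neg x x)]

theorem dyadicApprox_le_succ (h : IsMVAlgebra add neg zero one) (h1 : neg zero = one) (n : ℕ)
    (x : C) : dyadicApprox add neg one n x ≤ dyadicApprox add neg one (n + 1) x := by
  induction n generalizing x with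
  | zero =>
    by_cases hx : x = one
    · rw [hx, h.dyadicApprox_one h1, h.dyadicApprox_one h1]
    · rw [dyadicApprox, if_neg hx]
      exact dyadicApprox_nonneg _ _
  | succ n ih =>
    rw [dyadicApprox, dyadicApprox]
    linarith [ih (add x x), ih (mul add neg x x)]

theorem abs_dyadicApprox_add_neg_sub_one_le (h : IsMVAlgebra add neg zero one)
    (h1 : neg zero = one) (hne : zero ≠ one)
    (hc : ∀ x y, mul add neg x y = zero ∨ add x y = one) (n : ℕ) (x : C) :
    |dyadicApprox add neg one n x + dyadicApprox add neg one n (neg x) - 1| ≤ (1 / 2) ^ n := by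
  induction n generalizing x with
  | zero =>
    by_cases hx : x = one
    · simp [dyadicApprox, hx, h.neg_one h1, hne]
    · by_cases hx' : neg x = one <;> simp [dyadicApprox, hx, hx']
  | succ n ih =>
    rw [dyadicApprox, dyadicApprox, h.mul_neg_self, ← h.neg_mul_self, pow_succ]
    have i1 := abs_le.1 (ih (add x x))
    have i2 := abs_le.1 (ih (mul add neg x x))
    rw [abs_le]
    rcases hc x x with hx | hx
    · rw [hx, h1, h.dyadicApprox_one h1, h.dyadicApprox_zero h1 hne]
      constructor <;> linarith
    · rw [hx, h.neg_one h1, h.dyadicApprox_one h1, h.dyadicApprox_zero h1 hne]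
      constructor <;> linarith

/-- Doubling a disjoint pair moves the additivity defect down one level. The new pair is `(2x, 2y)`
when both elements are at most a half; otherwise the larger one is replaced by its square and the
other is doubled. -/
theorem two_mul_dyadicApprox_succ_add (h : IsMVAlgebra add neg zero one)
    (h1 : neg zero = one) (hne : zero ≠ one)
    (hc : ∀ x y, mul add neg x y = zero ∨ add x y = one) (n : ℕ) {x y : C}
    (hxy : mul add neg x y = zero) :
    ∃ u v, 2 * (dyadicApprox add neg one (n + 1) (add x y) - dyadicApprox add neg one (n + 1) x
        - dyadicApprox add neg one (n + 1) y)
      = dyadicApprox add neg one n (add u v) + dyadicApprox add neg one n (mul add neg u v)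
        - dyadicApprox add neg one n u - dyadicApprox add neg one n v := by
  have key : ∀ x y : C, mul add neg x y = zero → add x x = one →
      2 * (dyadicApprox add neg one (n + 1) (add x y) - dyadicApprox add neg one (n + 1) x
        - dyadicApprox add neg one (n + 1) y)
      = dyadicApprox add neg one n (add (mul add neg x x) (add y y))
        + dyadicApprox add neg one n (mul add neg (mul add neg x x) (add y y))
        - dyadicApprox add neg one n (mul add neg x x) - dyadicApprox add neg one n (add y y) := by
    intro x y hxy hx
    have h2 : add (add x y) (add x y) = one := by
      rw [h.add_comm x y, h.add_assoc y, ← h.add_assoc x, h.add_comm x y, h.add_assoc y, hx,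
        h.add_one, h.add_one]
    simp only [dyadicApprox]
    rw [h2, h.mul_self_add_of_add_self h1 hxy hx, h.mul_self_mul_add_self h1 hxy, hx,
      h.mul_self_of_add_self h1 hxy hx, h.dyadicApprox_one h1, h.dyadicApprox_zero h1 hne]
    ring
  rcases hc x x with hx | hx
  · rcases hc y y with hy | hy
    · refine ⟨add x x, add y y, ?_⟩
      have h2 : add (add x y) (add x y) = add (add x x) (add y y) := by
        rw [h.add_assoc x, ← h.add_assoc y, h.add_comm y x, h.add_assoc x y, ← h.add_assoc]
      simp only [dyadicApprox]
      rw [h2, h.mul_self_add h1 hc hxy hx hy, hx, hy, h.dyadicApprox_zero h1 hne]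
      ring
    · refine ⟨_, _, Eq.trans ?_ (key y x (by rw [h.mul_comm, hxy]) hy)⟩
      rw [h.add_comm]
      ring
  · exact ⟨_, _, key x y hxy hx⟩

/-- The defect at level `n + 1` is at most half that at level `n`, plus three negation errors of
size `2⁻ⁿ⁻¹`. These arise when a pair with sum `one` is replaced by its disjoint pair of negations.
The linear factor absorbs the accumulated errors. -/
theorem abs_dyadicApprox_add_mul_le (h : IsMVAlgebra add neg zero one)
    (h1 : neg zero = one) (hne : zero ≠ one)
    (hc : ∀ x y, mul add neg x y = zero ∨ add x y = one) (n : ℕ) (x y : C) :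
    |dyadicApprox add neg one n (add x y) + dyadicApprox add neg one n (mul add neg x y)
      - dyadicApprox add neg one n x - dyadicApprox add neg one n y|
      ≤ (2 + 4 * n) * (1 / 2) ^ n := by
  induction n generalizing x y with
  | zero =>
    have b0 := dyadicApprox_nonneg (add := add) (neg := neg) (one := one) 0
    have b1 := dyadicApprox_le_one (add := add) (neg := neg) (one := one) 0
    rw [abs_le]
    norm_num
    constructor <;>
      linarith [b0 x, b0 y, b0 (add x y), b0 (mul add neg x y), b1 x, b1 y, b1 (add x y),
        b1 (mul add neg x y)]
  | succ n ih =>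
    have key : ∀ x y : C, mul add neg x y = zero →
        |dyadicApprox add neg one (n + 1) (add x y) - dyadicApprox add neg one (n + 1) x
          - dyadicApprox add neg one (n + 1) y| ≤ (1 + 2 * n) * (1 / 2) ^ n := by
      intro x y hxy
      obtain ⟨u, v, huv⟩ := h.two_mul_dyadicApprox_succ_add h1 hne hc n hxy
      have := abs_le.1 (huv ▸ ih u v)
      rw [abs_le]
      constructor <;> linarith
    have hp : (0 : ℝ) < (1 / 2) ^ n := by positivity
    have hs : ((2 : ℝ) + 4 * ((n + 1 : ℕ) : ℝ)) * (1 / 2) ^ (n + 1)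
        = (1 + 2 * n) * (1 / 2) ^ n + 2 * (1 / 2) ^ n := by
      push_cast
      ring
    rw [hs, abs_le]
    rcases hc x y with hxy | hxy
    · rw [hxy, h.dyadicApprox_zero h1 hne]
      have := abs_le.1 (key x y hxy)
      constructor <;> linarith
    · have hm : mul add neg (neg x) (neg y) = zero := by
        rw [mul, h.neg_neg, h.neg_neg, hxy, h.neg_one h1]
      have := abs_le.1 (key _ _ hm)
      have hg := fun z => abs_le.1 (h.abs_dyadicApprox_add_neg_sub_one_le h1 hne hc (n + 1) z)
      have g1 := hg x
      have g2 := hg y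
      have g3 := hg (mul add neg x y)
      rw [show neg (mul add neg x y) = add (neg x) (neg y) by rw [mul, h.neg_neg]] at g3
      rw [hxy, h.dyadicApprox_one h1]
      rw [pow_succ] at g1 g2 g3
      constructor <;> linarith

/-- Every nontrivial MV-chain carries a homomorphism to the real unit interval. -/
theorem exists_state_of_chain (h : IsMVAlgebra add neg zero one) (h1 : neg zero = one)
    (hne : zero ≠ one) (hc : ∀ x y, mul add neg x y = zero ∨ add x y = one) :
    ∃ s : C → ℝ, (∀ x, 0 ≤ s x) ∧ (∀ x, s x ≤ 1) ∧ s zero = 0 ∧ s one = 1 ∧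
      (∀ x, s (neg x) = 1 - s x) ∧ ∀ x y, s (add x y) = min (s x + s y) 1 := by
  have hbdd : ∀ x, BddAbove (Set.range fun n => dyadicApprox add neg one n x) := fun x =>
    ⟨1, by rintro _ ⟨n, rfl⟩; exact dyadicApprox_le_one n x⟩
  let s : C → ℝ := fun x => ⨆ n, dyadicApprox add neg one n x
  have ht : ∀ x, Filter.Tendsto (fun n => dyadicApprox add neg one n x) Filter.atTop
      (nhds (s x)) := fun x =>
    tendsto_atTop_ciSup (monotone_nat_of_le_succ fun n => h.dyadicApprox_le_succ h1 n x) (hbdd x)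
  have h0 : ∀ x, 0 ≤ s x := fun x => ge_of_tendsto' (ht x) fun n => dyadicApprox_nonneg n x
  have hle : ∀ x, s x ≤ 1 := fun x => le_of_tendsto' (ht x) fun n => dyadicApprox_le_one n x
  have hz : s zero = 0 := by
    refine tendsto_nhds_unique (ht zero) ?_
    simp only [h.dyadicApprox_zero h1 hne, tendsto_const_nhds]
  have ho : s one = 1 := by
    refine tendsto_nhds_unique (ht one) ?_
    simp only [h.dyadicApprox_one h1, tendsto_const_nhds]
  -- In the limit the defect vanishes and `s` is an exact valuation. In a chain either the product
  -- is `zero` or the sum is `one`, which turns the valuation identity into truncated addition.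
  have hadd : ∀ x y, s (add x y) + s (mul add neg x y) - s x - s y = 0 := by
    intro x y
    refine tendsto_nhds_unique ((((ht _).add (ht _)).sub (ht x)).sub (ht y)) ?_
    refine squeeze_zero_norm (h.abs_dyadicApprox_add_mul_le h1 hne hc · x y) ?_
    have e1 := tendsto_pow_atTop_nhds_zero_of_lt_one (r := (1 / 2 : ℝ)) (by norm_num) (by norm_num)
    have e2 := tendsto_self_mul_const_pow_of_lt_one (r := (1 / 2 : ℝ)) (by norm_num) (by norm_num)
    have := (e1.const_mul 2).add (e2.const_mul 4)
    simp only [MulZeroClass.mul_zero, _root_.add_zero] at this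
    refine this.congr fun n => by ring
  have hneg : ∀ x, s (neg x) = 1 - s x := by
    intro x
    have := hadd x (neg x)
    rw [mul, h.neg_neg, h.neg_add_self h1, h.add_neg_self h1, h.neg_one h1, hz, ho] at this
    linarith
  refine ⟨s, h0, hle, hz, ho, hneg, fun x y => ?_⟩
  have := hadd x y
  rcases hc x y with hxy | hxy
  · rw [hxy, hz] at this
    rw [min_eq_left] <;> linarith [hle (add x y)]
  · rw [hxy, ho] at this
    rw [hxy, ho, min_eq_right]
    linarith [h0 (mul add neg x y)]

end Chain

end IsMVAlgebra

namespace EMVAlgebra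

/-! ### Truncated subtraction in intervals `[0, b]` -/

section Residuation

variable {M : Type*} [DistribLattice M] [OrderBot M] [EMVAlgebra M]

theorem bot_oplus (x : M) : oplus ⊥ x = x := by rw [oplus_comm, oplus_bot]

theorem lam_bot {b : M} (hb : IsIdem b) : lam b ⊥ = b := by
  rw [← lam_self hb, lam_lam hb le_rfl]

theorem oplus_lam {b x : M} (hb : IsIdem b) (hx : x ≤ b) : oplus x (lam b x) = b := by
  rw [oplus_comm, lam_oplus hb hx]

theorem lam_le_iff {b x z : M} (hb : IsIdem b) (hx : x ≤ b) (hz : z ≤ b) :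
    lam b x ≤ z ↔ b ≤ oplus z x := by
  refine ⟨fun h => ?_, fun h => lam_le_of hb hx hz (le_antisymm (oplus_le_idem hb hz hx) h)⟩
  conv_lhs => rw [← lam_oplus hb hx]
  exact oplus_mono h le_rfl

theorem lam_anti {b x y : M} (hb : IsIdem b) (hxy : x ≤ y) (hy : y ≤ b) : lam b y ≤ lam b x := by
  rw [lam_le_iff hb hy (lam_le hb (hxy.trans hy))]
  conv_lhs => rw [← lam_oplus hb (hxy.trans hy)]
  exact oplus_mono le_rfl hxy

/-- This is the adjunction for truncated subtraction: `lam b (oplus p (lam b t))` plays the role of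
`t ⊖ p`. -/
theorem lam_oplus_lam_le_iff {b p q t : M} (hb : IsIdem b) (hp : p ≤ b) (hq : q ≤ b)
    (ht : t ≤ b) : lam b (oplus p (lam b t)) ≤ q ↔ t ≤ oplus p q := by
  have htl := lam_le hb ht
  rw [lam_le_iff hb (oplus_le_idem hb hp htl) hq, ← oplus_assoc, oplus_comm q p,
    ← lam_le_iff hb htl (oplus_le_idem hb hp hq), lam_lam hb ht]

theorem le_oplus_inf {t p q r : M} (hq : t ≤ oplus p q) (hr : t ≤ oplus p r) :
    t ≤ oplus p (q ⊓ r) := by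
  obtain ⟨c, hc, hcu⟩ := exists_idempotent_ge ((t ⊔ p) ⊔ (q ⊔ r))
  have htc : t ≤ c := (le_sup_left.trans le_sup_left).trans hcu
  have hpc : p ≤ c := (le_sup_right.trans le_sup_left).trans hcu
  have hqc : q ≤ c := (le_sup_left.trans le_sup_right).trans hcu
  have hrc : r ≤ c := (le_sup_right.trans le_sup_right).trans hcu
  rw [← lam_oplus_lam_le_iff hc hpc (inf_le_left.trans hqc) htc]
  exact le_inf ((lam_oplus_lam_le_iff hc hpc hqc htc).2 hq)
    ((lam_oplus_lam_le_iff hc hpc hrc htc).2 hr)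

/-- Since `z ≤ lam b w`, the element `lam b w` has the form `z ⊕ r`. Then `b = w ⊕ z ⊕ r = z ⊕ r =
lam b w`, which forces `w = ⊥`. -/
theorem eq_bot_of_oplus_eq_self {b z w : M} (hb : IsIdem b) (hz : z ≤ b) (hw : w ≤ lam b z)
    (h : oplus z w = z) : w = ⊥ := by
  have hwb : w ≤ b := hw.trans (lam_le hb hz)
  have hzw : z ≤ lam b w := by
    have := lam_anti hb hw (lam_le hb hz)
    rwa [lam_lam hb hz] at this
  have h1 := eq_oplus_of_le hb hzw (lam_le hb hwb)
  have h2 := oplus_lam hb hwb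
  rw [← h1, ← oplus_assoc, oplus_comm w z, h, h1] at h2
  rw [← lam_lam hb hwb, h2, lam_self hb]

/-- The two truncated differences of a pair of elements are disjoint. -/
theorem sub_inf_sub {b p q : M} (hb : IsIdem b) (hp : p ≤ b) (hq : q ≤ b) :
    lam b (oplus q (lam b p)) ⊓ lam b (oplus p (lam b q)) = ⊥ := by
  -- Subtracting `q` from `p` is the same as subtracting `p ⊓ q`, so both differences can be taken
  -- over one element `z = p ⊓ q`.
  have key : ∀ {p q : M}, p ≤ b → q ≤ b →
      lam b (oplus q (lam b p)) = lam b (oplus (p ⊓ q) (lam b p)) := by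
    intro p q hp hq
    have hpq : p ⊓ q ≤ b := inf_le_left.trans hp
    have hql := oplus_le_idem hb hq (lam_le hb hp)
    refine le_antisymm (lam_anti hb (oplus_mono inf_le_right le_rfl) hql) ?_
    have h := (lam_oplus_lam_le_iff hb hq (lam_le hb hql) hp).1 le_rfl
    rw [lam_oplus_lam_le_iff hb hpq (lam_le hb hql) hp, oplus_comm]
    exact le_oplus_inf (le_oplus_right _ _) (h.trans (oplus_comm _ _).le)
  have hz : p ⊓ q ≤ b := inf_le_left.trans hp
  rw [key hp hq, key hq hp, inf_comm q p]
  -- Adding the meet of the two differences to `z` stays below both `p` and `q`, hence below `z`;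
  -- cancellation then applies.
  refine eq_bot_of_oplus_eq_self hb hz (inf_le_left.trans (lam_anti hb (le_oplus_left _ _)
    (oplus_le_idem hb hz (lam_le hb hp)))) (le_antisymm (le_inf ?_ ?_) (le_oplus_left _ _))
  · exact (oplus_mono le_rfl inf_le_left).trans (eq_oplus_of_le hb inf_le_left hp).le
  · exact (oplus_mono le_rfl inf_le_right).trans (eq_oplus_of_le hb inf_le_right hq).le

theorem inf_idem_oplus {b x y : M} (hb : IsIdem b) :
    oplus x y ⊓ b = oplus (x ⊓ b) (y ⊓ b) := by
  refine le_antisymm ?_ (le_inf (oplus_mono inf_le_left inf_le_left)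
    (oplus_le_idem hb inf_le_right inf_le_right))
  rw [inf_comm, inf_comm x, inf_comm y]
  exact inf_oplus_le b x y

theorem inf_lam_self {b e : M} (hb : IsIdem b) (he : IsIdem e) (heb : e ≤ b) :
    e ⊓ lam b e = ⊥ := by
  have hl := lam_le hb heb
  refine eq_bot_of_oplus_eq_self hb heb inf_le_right (le_antisymm ?_ (le_oplus_left _ _))
  exact oplus_le_idem he le_rfl inf_le_left

end Residuation

/-! ### The quotient chain of a maximal ideal -/

section Quotient

variable {M : Type*} [DistribLattice M] [OrderBot M] [EMVAlgebra M]

theorem IsIdeal.bot_mem {A : Set M} (hA : IsIdeal A) : ⊥ ∈ A := by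
  obtain ⟨x, hx⟩ := hA.nonempty
  exact hA.mem_of_le _ _ bot_le hx

theorem IsIdeal.exists_idem_notMem {A : Set M} (hA : IsIdeal A) (hne : A ≠ Set.univ) (x : M) :
    ∃ b, IsIdem b ∧ x ≤ b ∧ b ∉ A := by
  obtain ⟨y, hy⟩ := (Set.ne_univ_iff_exists_notMem A).1 hne
  obtain ⟨b, hb, hxy⟩ := exists_idempotent_ge (x ⊔ y)
  exact ⟨b, hb, le_sup_left.trans hxy, fun h => hy (hA.mem_of_le _ _ (le_sup_right.trans hxy) h)⟩

/-- The congruence on `[0, b]` induced by an ideal. -/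
def iicSetoid {A : Set M} (hA : IsIdeal A) (b : M) : Setoid (Set.Iic b) where
  r x y := ∃ a ∈ A, a ≤ b ∧ x.1 ≤ oplus y.1 a ∧ y.1 ≤ oplus x.1 a
  iseqv :=
    { refl := fun x => ⟨⊥, hA.bot_mem, bot_le, le_oplus_left _ _, le_oplus_left _ _⟩
      symm := fun ⟨a, ha, hab, h1, h2⟩ => ⟨a, ha, hab, h2, h1⟩
      trans := by
        rintro x y z ⟨a, ha, hab, h1, h2⟩ ⟨c, hc, hcb, h3, h4⟩
        -- The sum is cut down to stay in `[0, b]`; `le_oplus_inf` shows that the cut costs nothing.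
        refine ⟨oplus a c ⊓ b, hA.mem_of_le _ _ inf_le_left (hA.oplus_mem _ _ ha hc),
          inf_le_right, le_oplus_inf ?_ (x.2.trans (le_oplus_right _ _)),
          le_oplus_inf ?_ (z.2.trans (le_oplus_right _ _))⟩
        · rw [oplus_comm a c, ← oplus_assoc]
          exact h1.trans (oplus_mono h3 le_rfl)
        · rw [← oplus_assoc]
          exact h4.trans (oplus_mono h2 le_rfl) }

theorem oplus_le_oplus_oplus {x x' y y' a c : M} (h : x ≤ oplus x' a) (h' : y ≤ oplus y' c) :
    oplus x y ≤ oplus (oplus x' y') (oplus a c) := by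
  refine (oplus_mono h h').trans (le_of_eq ?_)
  rw [oplus_assoc, oplus_assoc, ← oplus_assoc a, oplus_comm a y', oplus_assoc y']

theorem lam_le_lam_oplus {b x y a : M} (hb : IsIdem b) (hx : x ≤ b) (hy : y ≤ b) (ha : a ≤ b)
    (h : x ≤ oplus y a) : lam b y ≤ oplus (lam b x) a := by
  rw [lam_le_iff hb hy (oplus_le_idem hb (lam_le hb hx) ha), oplus_assoc, oplus_comm a y]
  conv_lhs => rw [← lam_oplus hb hx]
  exact oplus_mono le_rfl h

variable {A : Set M} {b : M}

/-- The addition of the quotient of `[0, b]` by an ideal. -/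
def iicQuotAdd (hA : IsIdeal A) (hb : IsIdem b) :
    Quotient (iicSetoid hA b) → Quotient (iicSetoid hA b) → Quotient (iicSetoid hA b) :=
  Quotient.map₂ (fun x y => ⟨oplus x y, oplus_le_idem hb x.2 y.2⟩) <| by
    rintro x x' ⟨a, ha, hab, h1, h2⟩ y y' ⟨c, hc, hcb, h3, h4⟩
    exact ⟨oplus a c, hA.oplus_mem _ _ ha hc, oplus_le_idem hb hab hcb,
      oplus_le_oplus_oplus h1 h3, oplus_le_oplus_oplus h2 h4⟩

/-- The negation of the quotient of `[0, b]` by an ideal. -/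
noncomputable def iicQuotNeg (hA : IsIdeal A) (hb : IsIdem b) :
    Quotient (iicSetoid hA b) → Quotient (iicSetoid hA b) :=
  Quotient.map (fun x => ⟨lam b x, lam_le hb x.2⟩) <| by
    rintro x y ⟨a, ha, hab, h1, h2⟩
    exact ⟨a, ha, hab, lam_le_lam_oplus hb y.2 x.2 hab h2, lam_le_lam_oplus hb x.2 y.2 hab h1⟩

theorem isMVAlgebra_iicQuot (hA : IsIdeal A) (hb : IsIdem b) :
    IsMVAlgebra (iicQuotAdd hA hb) (iicQuotNeg hA hb) (Quotient.mk _ ⟨⊥, bot_le⟩)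
      (Quotient.mk _ ⟨b, le_rfl⟩) := by
  constructor
  · rintro ⟨x⟩ ⟨y⟩ ⟨z⟩
    exact congrArg (Quotient.mk _) (Subtype.ext (oplus_assoc _ _ _))
  · rintro ⟨x⟩ ⟨y⟩
    exact congrArg (Quotient.mk _) (Subtype.ext (oplus_comm _ _))
  · rintro ⟨x⟩
    exact congrArg (Quotient.mk _) (Subtype.ext (oplus_bot _))
  · rintro ⟨x⟩
    exact congrArg (Quotient.mk _) (Subtype.ext (lam_lam hb x.2))
  · rintro ⟨x⟩
    exact congrArg (Quotient.mk _) (Subtype.ext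
      (le_antisymm (oplus_le_idem hb x.2 le_rfl) (le_oplus_right _ _)))
  · rintro ⟨x⟩ ⟨y⟩
    exact congrArg (Quotient.mk _) (Subtype.ext (oplus_lam_oplus_lam hb x.2 y.2))

theorem IsMaximalIdeal.exists_state_Iic (hA : IsMaximalIdeal A) (hb : IsIdem b) (hbA : b ∉ A) :
    ∃ s : M → ℝ, (∀ x, 0 ≤ s x) ∧ (∀ x, s x ≤ 1) ∧ (∀ x, s x = s (x ⊓ b)) ∧
      (∀ x ∈ A, s x = 0) ∧ s b = 1 ∧ (∀ x ≤ b, s (lam b x) = 1 - s x) ∧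
      ∀ x ≤ b, ∀ y ≤ b, s (oplus x y) = min (s x + s y) 1 := by
  have hI := hA.isIdeal
  let mk : Set.Iic b → Quotient (iicSetoid hI b) := Quotient.mk _
  have hne : mk ⟨⊥, bot_le⟩ ≠ mk ⟨b, le_rfl⟩ := by
    intro h
    obtain ⟨a, ha, -, -, h2⟩ := Quotient.exact h
    rw [bot_oplus] at h2
    exact hbA (hI.mem_of_le _ _ h2 ha)
  obtain ⟨s, h0, h1, hz, ho, hneg, hadd⟩ :=
    (isMVAlgebra_iicQuot hI hb).exists_state_of_chain
      (congrArg mk (Subtype.ext (lam_bot hb))) hne (by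
        rintro ⟨x⟩ ⟨y⟩
        -- With `lam b y` and `x` as the pair, the disjoint differences are the negation of `x ⊕ y`
        -- and the product of `x` and `y`. By primeness one of them lies in `A`, so in the quotient
        -- the sum is the unit or the product is zero.
        have hd := sub_inf_sub hb (lam_le hb y.2) x.2
        rw [lam_lam hb y.2, oplus_comm (lam b y.1)] at hd
        have hs := oplus_le_idem hb (lam_le hb x.2) (lam_le hb y.2)
        rcases hA.mem_or_mem (hd ▸ hI.bot_mem) with h | h
        · refine Or.inr (Quotient.sound ⟨_, h, lam_le hb (oplus_le_idem hb x.2 y.2), ?_, ?_⟩)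
          · exact (oplus_le_idem hb x.2 y.2).trans (le_oplus_left _ _)
          · exact (oplus_lam hb (oplus_le_idem hb x.2 y.2)).ge
        · refine Or.inl (Quotient.sound ⟨_, h, lam_le hb hs, le_oplus_right _ _, bot_le⟩))
  have hmk : ∀ {x : M} (hx : x ≤ b), mk ⟨x ⊓ b, inf_le_right⟩ = mk ⟨x, hx⟩ := fun hx =>
    congrArg mk (Subtype.ext (inf_eq_left.2 hx))
  refine ⟨fun x => s (mk ⟨x ⊓ b, inf_le_right⟩), fun _ => h0 _, fun _ => h1 _, fun x => ?_,
    fun x hx => ?_, ?_, fun x hx => ?_, fun x hx y hy => ?_⟩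
  · simp only [inf_assoc, inf_idem]
  · refine Eq.trans (congrArg s ?_) hz
    exact Quotient.sound ⟨x ⊓ b, hI.mem_of_le _ _ inf_le_left hx, inf_le_right,
      le_oplus_right _ _, bot_le⟩
  · simp only
    rw [hmk le_rfl, ho]
  · simp only
    rw [hmk hx, hmk (lam_le hb hx)]
    exact hneg (mk ⟨x, hx⟩)
  · simp only
    rw [hmk hx, hmk hy, hmk (oplus_le_idem hb hx hy)]
    exact hadd (mk ⟨x, hx⟩) (mk ⟨y, hy⟩)

end Quotient

/-! ### State-morphisms and their kernels -/

section StateMorphism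

variable {M : Type*} [DistribLattice M] [OrderBot M] [EMVAlgebra M]

theorem coe_oplus (x y : unitInterval) : (oplus x y : unitInterval).1 = min (x.1 + y.1) 1 := rfl

theorem unitInterval.eq_zero_or_one_of_isIdem {b : unitInterval} (hb : IsIdem b) :
    b.1 = 0 ∨ b.1 = 1 := by
  have h : min (b.1 + b.1) 1 = b.1 := congrArg Subtype.val hb
  grind

theorem coe_lam {b x : unitInterval} (hb : IsIdem b) (hx : x ≤ b) : (lam b x).1 = b.1 - x.1 := by
  have hx' : x.1 ≤ b.1 := hx
  have h1 : min ((lam b x).1 + x.1) 1 = b.1 := congrArg Subtype.val (lam_oplus hb hx)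
  have h2 : lam b x ≤ ⟨b.1 - x.1, by linarith, by linarith [b.2.2, x.2.1]⟩ := by
    refine lam_le_of hb hx (by change b.1 - x.1 ≤ b.1; linarith [x.2.1]) (Subtype.ext ?_)
    rw [coe_oplus, sub_add_cancel, min_eq_left b.2.2]
  have h3 : (lam b x).1 ≤ b.1 - x.1 := h2
  have := min_le_left ((lam b x).1 + x.1) 1
  linarith

theorem oplus_lam_oplus_lam_eq_sup {b x y : M} (hb : IsIdem b) (hx : x ≤ b) (hy : y ≤ b) :
    oplus y (lam b (oplus y (lam b x))) = x ⊔ y := by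
  have hyl := oplus_le_idem hb hy (lam_le hb hx)
  refine le_antisymm ?_ (sup_le ?_ (le_oplus_left _ _))
  · have h := eq_oplus_of_le hb (le_sup_right : y ≤ x ⊔ y) (sup_le hx hy)
    refine (oplus_mono le_rfl ?_).trans h.le
    rw [lam_oplus_lam_le_iff hb hy (lam_le hb (oplus_le_idem hb hy (lam_le hb (sup_le hx hy)))) hx,
      h]
    exact le_sup_left
  · exact (lam_oplus_lam_le_iff hb hy (lam_le hb hyl) hx).1 le_rfl

theorem lam_sup_lam {b x y : M} (hb : IsIdem b) (hx : x ≤ b) (hy : y ≤ b) :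
    lam b (lam b x ⊔ lam b y) = x ⊓ y := by
  have hlx := lam_le hb hx
  have hly := lam_le hb hy
  have hxy : x ⊓ y ≤ b := inf_le_left.trans hx
  refine le_antisymm (le_inf ?_ ?_) ?_
  · conv_rhs => rw [← lam_lam hb hx]
    exact lam_anti hb le_sup_left (sup_le hlx hly)
  · conv_rhs => rw [← lam_lam hb hy]
    exact lam_anti hb le_sup_right (sup_le hlx hly)
  · conv_lhs => rw [← lam_lam hb hxy]
    exact lam_anti hb (sup_le (lam_anti hb inf_le_left hx) (lam_anti hb inf_le_right hy))
      (lam_le hb hxy)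

theorem min_add_sub_min_add_sub {p q c : ℝ} (hc : c = 0 ∨ c = 1) (hp : 0 ≤ p) (hpc : p ≤ c)
    (hq : 0 ≤ q) (hqc : q ≤ c) : min (q + (c - min (q + (c - p)) 1)) 1 = max p q := by
  rcases hc with rfl | rfl
  · rw [le_antisymm hpc hp, le_antisymm hqc hq]
    norm_num
  · grind

/-- Join and meet inside `[0, b]` are terms in `oplus` and `lam b`, so preserving the latter
suffices; `s b` is `0` or `1`, being idempotent. The right-hand side consists of equations in
coordinates, which also makes it usable for closedness. -/
theorem isEMVHom_unitInterval_iff {s : M → unitInterval} :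
    IsEMVHom s ↔ (∀ x y, s (oplus x y) = oplus (s x) (s y)) ∧ s ⊥ = 0 ∧
      ∀ b x, IsIdem b → x ≤ b → (s (lam b x)).1 = (s b).1 - (s x).1 := by
  constructor
  · intro h
    refine ⟨h.map_oplus, h.map_bot, fun b x hb hx => ?_⟩
    have hsb : IsIdem (s b) := by
      rw [IsIdem, ← h.map_oplus, show oplus b b = b from hb]
    have hsx : s x ≤ s b := by
      rw [← sup_eq_right.2 hx, h.map_sup]
      exact le_sup_left
    rw [h.map_lam b x hb hx, coe_lam hsb hsx]
  · rintro ⟨hadd, hbot, hlam⟩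
    have hidem : ∀ {b}, IsIdem b → IsIdem (s b) := fun {b} hb => by
      rw [IsIdem, ← hadd, show oplus b b = b from hb]
    have hle : ∀ {b x}, IsIdem b → x ≤ b → s x ≤ s b := fun {b x} hb hx => by
      have := hlam b x hb hx
      have h0 := (s (lam b x)).2.1
      exact (by linarith : (s x).1 ≤ (s b).1)
    have hsup : ∀ x y, s (x ⊔ y) = s x ⊔ s y := by
      intro x y
      obtain ⟨b, hb, hxyb⟩ := exists_idempotent_ge (x ⊔ y)
      have hx := le_sup_left.trans hxyb
      have hy := le_sup_right.trans hxyb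
      have e : (s (x ⊔ y)).1 = max (s x).1 (s y).1 := by
        have h1 : (s x).1 ≤ (s b).1 := hle hb hx
        have h2 : (s y).1 ≤ (s b).1 := hle hb hy
        rw [← oplus_lam_oplus_lam_eq_sup hb hx hy, hadd, coe_oplus,
          hlam _ _ hb (oplus_le_idem hb hy (lam_le hb hx)), hadd, coe_oplus, hlam _ _ hb hx]
        exact min_add_sub_min_add_sub (unitInterval.eq_zero_or_one_of_isIdem (hidem hb))
          (s x).2.1 h1 (s y).2.1 h2
      exact Subtype.ext e
    refine ⟨hsup, fun x y => ?_, hadd, hbot, fun b x hb hx => Subtype.ext ?_⟩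
    · obtain ⟨b, hb, hxyb⟩ := exists_idempotent_ge (x ⊔ y)
      have hx := le_sup_left.trans hxyb
      have hy := le_sup_right.trans hxyb
      have e : (s (x ⊓ y)).1 = min (s x).1 (s y).1 := by
        have e1 : (s (lam b x ⊔ lam b y)).1 = max (s (lam b x)).1 (s (lam b y)).1 :=
          congrArg Subtype.val (hsup _ _)
        rw [← lam_sup_lam hb hx hy, hlam _ _ hb (sup_le (lam_le hb hx) (lam_le hb hy)), e1,
          hlam _ _ hb hx, hlam _ _ hb hy, max_sub_sub_left, sub_sub_cancel]
      exact Subtype.ext e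
    · rw [hlam b x hb hx, coe_lam (hidem hb) (hle hb hx)]

/-- This compares negations relative to two unrelated idempotents. In `d = b ⊔ c`, `lam c x` is
below `lam b (x ⊓ b) ⊕ lam d b`, and meeting with `b` removes the last summand. -/
theorem lam_inf_le_lam_inf {b c x : M} (hb : IsIdem b) (hc : IsIdem c) (hx : x ≤ c) :
    lam c x ⊓ b ≤ lam b (x ⊓ b) := by
  set d := b ⊔ c with hd
  have hdi : IsIdem d := hb.sup hc
  have hbd : b ≤ d := le_sup_left
  have h1 : lam c x ≤ oplus (lam b (x ⊓ b)) (lam d b) ⊓ c := by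
    rw [lam_le_iff hc hx inf_le_right, oplus_comm]
    refine le_oplus_inf (le_sup_right.trans (b := d) ?_) (le_oplus_right _ _)
    rw [oplus_comm, oplus_assoc, oplus_comm _ x, ← oplus_assoc]
    conv_lhs => rw [← oplus_lam hdi hbd]
    refine oplus_mono ?_ le_rfl
    conv_lhs => rw [← lam_oplus hb (inf_le_right : x ⊓ b ≤ b)]
    exact oplus_mono le_rfl inf_le_left
  refine (inf_le_inf_right b (h1.trans inf_le_left)).trans ?_
  rw [inf_idem_oplus hb, inf_comm (lam d b), inf_lam_self hdi hb hbd, oplus_bot]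
  exact inf_le_left

theorem IsMaximalIdeal.exists_stateMorphism {A : Set M} (hA : IsMaximalIdeal A) :
    ∃ s : StateMorphism M, ∀ x ∈ A, s.1 x = 0 := by
  obtain ⟨b, hb, -, hbA⟩ := hA.isIdeal.exists_idem_notMem hA.ne_univ ⊥
  obtain ⟨s, h0, h1, hinf, hz, ho, hneg, hadd⟩ := hA.exists_state_Iic hb hbA
  have hadd' : ∀ x y, s (oplus x y) = min (s x + s y) 1 := by
    intro x y
    rw [hinf, inf_idem_oplus hb, hadd _ inf_le_right _ inf_le_right, ← hinf, ← hinf]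
  refine ⟨⟨fun x => ⟨s x, h0 x, h1 x⟩, isEMVHom_unitInterval_iff.2
    ⟨fun x y => Subtype.ext (hadd' x y), Subtype.ext (hz _ hA.isIdeal.bot_mem),
      fun c x hc hx => ?_⟩, b, Subtype.ext ho⟩, fun x hx => Subtype.ext (hz x hx)⟩
  -- This bound makes the truncation in `s (lam c x ⊕ x)` inactive, so additivity gives the exact
  -- value of `s (lam c x)`.
  have hle : s (lam c x) ≤ 1 - s x := by
    have hl := lam_le hb (inf_le_right : x ⊓ b ≤ b)
    rw [hinf, hinf x, ← hneg _ inf_le_right,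
      ← eq_oplus_of_le hb (lam_inf_le_lam_inf hb hc hx) hl, hadd']
    exact le_min (le_add_of_nonneg_right (h0 _)) (h1 _)
  have := hadd' (lam c x) x
  rw [lam_oplus hc hx, min_eq_left (by linarith)] at this
  change s (lam c x) = s c - s x
  linarith

namespace StateMorphism

variable (s : StateMorphism M)

theorem map_oplus (x y : M) : (s.1 (oplus x y)).1 = min ((s.1 x).1 + (s.1 y).1) 1 :=
  congrArg Subtype.val (s.2.1.map_oplus x y)

theorem map_bot : s.1 ⊥ = 0 := s.2.1.map_bot

theorem map_lam {b x : M} (hb : IsIdem b) (hx : x ≤ b) :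
    (s.1 (lam b x)).1 = (s.1 b).1 - (s.1 x).1 :=
  (isEMVHom_unitInterval_iff.1 s.2.1).2.2 b x hb hx

theorem mono {x y : M} (h : x ≤ y) : (s.1 x).1 ≤ (s.1 y).1 := by
  have : s.1 x ≤ s.1 y := by
    rw [← sup_eq_right.2 h, s.2.1.map_sup]
    exact le_sup_left
  exact this

theorem map_idem {b : M} (hb : IsIdem b) : (s.1 b).1 = 0 ∨ (s.1 b).1 = 1 :=
  unitInterval.eq_zero_or_one_of_isIdem
    (by rw [IsIdem, ← s.2.1.map_oplus, show oplus b b = b from hb])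

theorem exists_idem_ge (x : M) : ∃ b, IsIdem b ∧ x ≤ b ∧ (s.1 b).1 = 1 := by
  obtain ⟨y, hy⟩ := s.2.2
  obtain ⟨b, hb, hxy⟩ := exists_idempotent_ge (x ⊔ y)
  refine ⟨b, hb, le_sup_left.trans hxy, le_antisymm (s.1 b).2.2 ?_⟩
  have := s.mono (le_sup_right.trans hxy)
  rwa [hy] at this

end StateMorphism

/-- The `n`-fold sum of an element. -/
def nmul : ℕ → M → M
  | 0, _ => ⊥
  | n + 1, x => oplus (nmul n x) x

theorem IsIdeal.nmul_mem {I : Set M} (hI : IsIdeal I) {x : M} (hx : x ∈ I) (n : ℕ) :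
    nmul n x ∈ I := by
  induction n with
  | zero => exact hI.bot_mem
  | succ n ih => exact hI.oplus_mem _ _ ih hx

theorem nmul_le {b x : M} (hb : IsIdem b) (hx : x ≤ b) (n : ℕ) : nmul n x ≤ b := by
  induction n with
  | zero => exact bot_le
  | succ n ih => exact oplus_le_idem hb ih hx

theorem nmul_add (m n : ℕ) (x : M) : nmul (m + n) x = oplus (nmul m x) (nmul n x) := by
  induction n with
  | zero => exact (oplus_bot _).symm
  | succ n ih => rw [← add_assoc, nmul, nmul, ih, oplus_assoc]

theorem StateMorphism.map_nmul (s : StateMorphism M) (n : ℕ) (x : M) :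
    (s.1 (nmul n x)).1 = min (n * (s.1 x).1) 1 := by
  induction n with
  | zero => simp [nmul, s.map_bot]
  | succ n ih =>
    rw [nmul, s.map_oplus, ih]
    have h0 := (s.1 x).2.1
    push_cast
    grind

/-- The reals are archimedean: if `s x > 0`, some multiple of `x` has value `1`, and its complement
in a suitable `[0, b]` lies in the kernel. An ideal containing the kernel and `x` therefore contains
every such `b`. -/
theorem StateMorphism.isMaximalIdeal_ker (s : StateMorphism M) :
    IsMaximalIdeal {x | s.1 x = 0} := by
  have h0 : ∀ {x}, s.1 x = 0 ↔ (s.1 x).1 = 0 := Subtype.ext_iff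
  have hI : IsIdeal {x | s.1 x = 0} := by
    refine ⟨⟨⊥, s.map_bot⟩, fun x y hxy hy => ?_, fun x y hx hy => ?_⟩
    · exact h0.2 (le_antisymm ((s.mono hxy).trans (h0.1 hy).le) (s.1 x).2.1)
    · refine h0.2 ?_
      rw [s.map_oplus, h0.1 hx, h0.1 hy]
      norm_num
  refine ⟨hI, fun h => ?_, fun J hJ hne hsub => ?_⟩
  · obtain ⟨x, hx⟩ := s.2.2
    have : x ∈ {x | s.1 x = 0} := h ▸ Set.mem_univ x
    rw [Set.mem_ofPred_eq, hx] at this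
    exact one_ne_zero this
  · by_contra hcon
    obtain ⟨x, hxJ, hx⟩ := Set.not_subset.1 fun h => hcon (h.antisymm hsub)
    have hx0 : 0 < (s.1 x).1 := lt_of_le_of_ne (s.1 x).2.1 fun h => hx (h0.2 h.symm)
    refine hne (Set.eq_univ_of_forall fun y => ?_)
    obtain ⟨b, hb, hxyb, hsb⟩ := s.exists_idem_ge (x ⊔ y)
    obtain ⟨n, hn⟩ := exists_nat_ge (1 / (s.1 x).1)
    rw [div_le_iff₀ hx0] at hn
    have hnb : nmul n x ≤ b := nmul_le hb (le_sup_left.trans hxyb) n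
    have hl : lam b (nmul n x) ∈ J := hsub <| h0.2 <| by
      rw [s.map_lam hb hnb, s.map_nmul, min_eq_right hn, hsb, sub_self]
    refine hJ.mem_of_le _ _ (le_sup_right.trans hxyb) ?_
    rw [← lam_oplus hb hnb]
    exact hJ.oplus_mem _ _ hl (hJ.nmul_mem hxJ n)

/-! ### The kernel map as a homeomorphism -/

namespace StateMorphism

/-- The kernel of a state-morphism, as a maximal ideal. -/
def ker (s : StateMorphism M) : MaxI M := ⟨{x | s.1 x = 0}, s.isMaximalIdeal_ker⟩

theorem mem_ker {s : StateMorphism M} {x : M} : x ∈ s.ker.1 ↔ s.1 x = 0 := Iff.rfl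

/-- The element `z` is independent of `t`. Passing to `2x` when `q ≤ 1/2`, or to `2x - 1` when `r ≥
1/2`, doubles the gap; if `1/2` lies strictly between `r` and `q`, truncated `2x - 1` already
separates. At `n = 0` the gap exceeds `1`, so one of the two conditions on `t x` is impossible and a
constant works. -/
theorem exists_separating (n : ℕ) {b : M} (hb : IsIdem b) {x : M} (hx : x ≤ b) {r q : ℝ}
    (h : 1 < 2 ^ n * (q - r)) :
    ∃ z ≤ b, ∀ t : StateMorphism M, (t.1 b).1 = 1 →
      ((t.1 x).1 ≤ r → t.1 z = 0) ∧ (q ≤ (t.1 x).1 → t.1 z ≠ 0) := by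
  have hsq : ∀ y ≤ b, ∃ z ≤ b, ∀ t : StateMorphism M, (t.1 b).1 = 1 →
      (t.1 z).1 = max (2 * (t.1 y).1 - 1) 0 := by
    intro y hy
    have hl := oplus_le_idem hb (lam_le hb hy) (lam_le hb hy)
    refine ⟨lam b (oplus (lam b y) (lam b y)), lam_le hb hl, fun t ht => ?_⟩
    rw [t.map_lam hb hl, t.map_oplus, t.map_lam hb hy, ht]
    grind
  induction n generalizing x r q with
  | zero =>
    rcases lt_or_ge r 0 with hr | hr
    · refine ⟨b, le_rfl, fun t ht => ⟨fun h => ?_, fun _ h => ?_⟩⟩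
      · linarith [(t.1 x).2.1]
      · rw [h] at ht
        exact zero_ne_one ht
    · refine ⟨⊥, bot_le, fun t ht => ⟨fun _ => t.map_bot, fun h => ?_⟩⟩
      linarith [(t.1 x).2.2]
  | succ n ih =>
    obtain ⟨y, hy, hty⟩ := hsq x hx
    rcases le_or_gt q (1 / 2) with hq | hq
    · obtain ⟨z, hz, htz⟩ := ih (oplus_le_idem hb hx hx) (r := 2 * r) (q := 2 * q)
        (by rw [pow_succ] at h; linarith)
      refine ⟨z, hz, fun t ht => ⟨fun h => (htz t ht).1 ?_, fun h => (htz t ht).2 ?_⟩⟩ <;>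
        rw [t.map_oplus] <;> grind
    · rcases le_or_gt (1 / 2) r with hr | hr
      · obtain ⟨z, hz, htz⟩ := ih hy (r := 2 * r - 1) (q := 2 * q - 1)
          (by rw [pow_succ] at h; linarith)
        refine ⟨z, hz, fun t ht => ⟨fun h => (htz t ht).1 ?_, fun h => (htz t ht).2 ?_⟩⟩ <;>
          rw [hty t ht] <;> grind
      · refine ⟨y, hy, fun t ht => ⟨fun h => Subtype.ext ?_, fun h h' => ?_⟩⟩
        · rw [hty t ht, max_eq_right (by linarith)]
          rfl
        · have := hty t ht
          rw [h'] at this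
          have h2 := le_max_left (2 * (t.1 x).1 - 1) 0
          rw [← this] at h2
          exact absurd h2 (by change ¬ _ ≤ (0 : ℝ); linarith)

/-- The set where `z` does not vanish is the preimage under `ker` of a hull-kernel open set, so a
strict inequality at `s` persists on a neighbourhood visible to kernels alone. -/
theorem exists_nhd_of_lt (s : StateMorphism M) {x : M} {r : ℝ} (h : r < (s.1 x).1) :
    ∃ z, s.1 z ≠ 0 ∧ ∀ t : StateMorphism M, t.1 z ≠ 0 → r < (t.1 x).1 := by
  obtain ⟨b, hb, hx, hsb⟩ := s.exists_idem_ge x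
  obtain ⟨n, hn⟩ := pow_unbounded_of_one_lt (1 / ((s.1 x).1 - r)) (one_lt_two (α := ℝ))
  rw [div_lt_iff₀ (by linarith)] at hn
  obtain ⟨z, hz, ht⟩ := exists_separating n hb hx hn
  refine ⟨z, (ht s hsb).2 le_rfl, fun t htz => ?_⟩
  have htb : (t.1 b).1 = 1 := by
    refine (t.map_idem hb).resolve_left fun h => htz (Subtype.ext ?_)
    exact le_antisymm ((t.mono hz).trans h.le) (t.1 z).2.1
  by_contra hcon
  exact htz ((ht t htb).1 (not_lt.1 hcon))

theorem exists_nhd_of_gt (s : StateMorphism M) {x : M} {r : ℝ} (h : (s.1 x).1 < r) :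
    ∃ z, s.1 z ≠ 0 ∧ ∀ t : StateMorphism M, t.1 z ≠ 0 → (t.1 x).1 < r := by
  obtain ⟨b, hb, hx, hsb⟩ := s.exists_idem_ge x
  obtain ⟨z, hz, ht⟩ := s.exists_nhd_of_lt (x := lam b x) (r := 1 - r)
    (by rw [s.map_lam hb hx, hsb]; linarith)
  refine ⟨z, hz, fun t htz => ?_⟩
  have := ht t htz
  rw [t.map_lam hb hx] at this
  linarith [(t.1 b).2.2]

theorem ker_injective : Function.Injective (ker : StateMorphism M → MaxI M) := by
  have key : ∀ s t : StateMorphism M, s.ker = t.ker → ∀ x, (s.1 x).1 ≤ (t.1 x).1 := by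
    intro s t h x
    by_contra hcon
    obtain ⟨z, hsz, ht⟩ := s.exists_nhd_of_lt (not_le.1 hcon)
    refine (ht t fun htz => hsz ?_).false
    rw [← mem_ker] at htz ⊢
    rwa [h]
  intro s t h
  exact Subtype.ext (funext fun x => Subtype.ext (le_antisymm (key s t h x) (key t s h.symm x)))

theorem ker_surjective : Function.Surjective (ker : StateMorphism M → MaxI M) := by
  intro A
  obtain ⟨s, hs⟩ := A.2.exists_stateMorphism
  exact ⟨s, Subtype.ext (A.2.eq_of_subset _ s.isMaximalIdeal_ker.isIdeal
    s.isMaximalIdeal_ker.ne_univ hs)⟩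

theorem continuous_eval (x : M) : Continuous fun s : StateMorphism M => s.1 x :=
  (continuous_apply x).comp continuous_subtype_val

theorem continuous_ker : Continuous (ker : StateMorphism M → MaxI M) := by
  refine ⟨?_⟩
  rintro _ ⟨I, -, rfl⟩
  have : ker ⁻¹' {A : MaxI M | ¬ I ⊆ A.1} = ⋃ x ∈ I, {s : StateMorphism M | s.1 x ≠ 0} := by
    ext s
    simp [Set.not_subset, mem_ker]
  rw [this]
  exact isOpen_biUnion fun x _ => isOpen_ne_fun (continuous_eval x) continuous_const

end StateMorphism

theorem MaxI.isOpen_setOf_notMem (z : M) : IsOpen {A : MaxI M | z ∉ A.1} := by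
  refine ⟨⋂₀ {J | IsIdeal J ∧ z ∈ J}, ⟨⟨⊥, fun J hJ => hJ.1.bot_mem⟩,
    fun x y h hy J hJ => hJ.1.mem_of_le x y h (hy J hJ),
    fun x y hx hy J hJ => hJ.1.oplus_mem x y (hx J hJ) (hy J hJ)⟩, ?_⟩
  ext A
  refine not_congr ⟨fun hz x hx => hx _ ⟨A.2.isIdeal, hz⟩, fun h => h fun J hJ => hJ.2⟩

theorem StateMorphism.isOpenMap_ker : IsOpenMap (ker : StateMorphism M → MaxI M) := by
  let e := Equiv.ofBijective (ker : StateMorphism M → MaxI M) ⟨ker_injective, ker_surjective⟩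
  have he : ∀ A, (e.symm A).ker = A := e.apply_symm_apply
  have hc : Continuous e.symm := by
    refine Continuous.subtype_mk (continuous_pi fun x => ?_) _
    rw [continuous_iff_continuousAt]
    intro A
    have hopen : ∀ z, (e.symm A).1 z ≠ 0 → ∀ᶠ B in nhds A, (e.symm B).1 z ≠ 0 := by
      intro z hz
      have hz' : z ∉ A.1 := by
        rw [← he A]
        exact hz
      filter_upwards [(MaxI.isOpen_setOf_notMem z).mem_nhds hz'] with B hB h
      rw [← he B] at hB
      exact hB h
    refine tendsto_order.2 ⟨fun r hr => ?_, fun r hr => ?_⟩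
    · obtain ⟨z, hz, ht⟩ := (e.symm A).exists_nhd_of_lt (show r.1 < _ from hr)
      filter_upwards [hopen z hz] with B hB using ht _ hB
    · obtain ⟨z, hz, ht⟩ := (e.symm A).exists_nhd_of_gt (show _ < r.1 from hr)
      filter_upwards [hopen z hz] with B hB using ht _ hB
  exact e.continuous_symm_iff.1 hc

variable (M) in
/-- State-morphisms correspond to maximal ideals, homeomorphically. -/
noncomputable def StateMorphism.kerHomeomorph : StateMorphism M ≃ₜ MaxI M :=
  (Equiv.ofBijective ker ⟨ker_injective, ker_surjective⟩).toHomeomorphOfContinuousOpen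
    continuous_ker isOpenMap_ker

end StateMorphism

/-! ### Contraction to the idempotents, and compactness -/

section Contraction

variable {M : Type*} [DistribLattice M] [OrderBot M] [EMVAlgebra M]

/-- Without a top, unions of chains of proper ideals need not be proper, so Zorn is applied to
ideals avoiding `c`. A maximal such `A` equals `{z | z ⊓ c ∈ A}`, hence contains `lam b c` for every
idempotent `b ≥ c`; a larger ideal contains `c`, thus every such `b`. -/
theorem IsIdeal.exists_isMaximalIdeal {I : Set M} (hI : IsIdeal I) {c : M} (hc : IsIdem c)
    (hcI : c ∉ I) : ∃ A : Set M, IsMaximalIdeal A ∧ I ⊆ A ∧ c ∉ A := by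
  obtain ⟨A, hIA, hA⟩ := zorn_subset_nonempty {J : Set M | IsIdeal J ∧ c ∉ J} (by
    intro S hS hchain ⟨J₀, hJ₀⟩
    refine ⟨⋃₀ S, ⟨⟨⟨⊥, J₀, hJ₀, (hS hJ₀).1.bot_mem⟩, ?_, ?_⟩, ?_⟩,
      fun J hJ => Set.subset_sUnion_of_mem hJ⟩
    · rintro x y hxy ⟨J, hJ, hy⟩
      exact ⟨J, hJ, (hS hJ).1.mem_of_le x y hxy hy⟩
    · rintro x y ⟨J, hJ, hx⟩ ⟨K, hK, hy⟩
      rcases hchain.total hJ hK with h | h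
      · exact ⟨K, hK, (hS hK).1.oplus_mem x y (h hx) hy⟩
      · exact ⟨J, hJ, (hS hJ).1.oplus_mem x y hx (h hy)⟩
    · rintro ⟨J, hJ, hcJ⟩
      exact (hS hJ).2 hcJ) I ⟨hI, hcI⟩
  have hAI : IsIdeal A := hA.prop.1
  refine ⟨A, ⟨hAI, fun h => hA.prop.2 (h ▸ Set.mem_univ c), fun J hJ hne hAJ => ?_⟩,
    hIA, hA.prop.2⟩
  by_contra hcon
  have hcJ : c ∈ J := by
    by_contra hcJ
    exact hcon ((hA.le_of_ge ⟨hJ, hcJ⟩ hAJ).antisymm hAJ)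
  have hK : IsIdeal {z : M | z ⊓ c ∈ A} := by
    refine ⟨⟨⊥, by simpa using hAI.bot_mem⟩,
      fun x y hxy hy => hAI.mem_of_le _ _ (inf_le_inf_right c hxy) hy, fun x y hx hy => ?_⟩
    change oplus x y ⊓ c ∈ A
    rw [inf_idem_oplus hc]
    exact hAI.oplus_mem _ _ hx hy
  have hKA : {z : M | z ⊓ c ∈ A} ⊆ A := hA.le_of_ge
    ⟨hK, fun h => hA.prop.2 (by simpa using h)⟩
    fun z hz => hAI.mem_of_le _ _ inf_le_left hz
  refine hne (Set.eq_univ_of_forall fun y => ?_)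
  obtain ⟨b, hb, hyb⟩ := exists_idempotent_ge (c ⊔ y)
  have hcb := le_sup_left.trans hyb
  have hl : lam b c ∈ A := hKA <| by
    change lam b c ⊓ c ∈ A
    rw [inf_comm, inf_lam_self hb hc hcb]
    exact hAI.bot_mem
  refine hJ.mem_of_le _ _ (le_sup_right.trans hyb) ?_
  rw [← oplus_lam hb hcb]
  exact hJ.oplus_mem _ _ hcJ (hAJ hl)

theorem IsMaximalIdeal.exists_le_oplus_nmul {A : Set M} (hA : IsMaximalIdeal A) {x : M}
    (hx : x ∉ A) (b : M) : ∃ y ∈ A, ∃ n, b ≤ oplus y (nmul n x) := by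
  have hI := hA.isIdeal
  have hJ : IsIdeal {b : M | ∃ y ∈ A, ∃ n, b ≤ oplus y (nmul n x)} := by
    refine ⟨⟨⊥, ⊥, hI.bot_mem, 0, bot_le⟩, fun u v huv ⟨y, hy, n, h⟩ => ⟨y, hy, n, huv.trans h⟩,
      fun u v ⟨y, hy, n, h⟩ ⟨z, hz, m, h'⟩ => ⟨oplus y z, hI.oplus_mem _ _ hy hz, n + m, ?_⟩⟩
    rw [nmul_add]
    refine (oplus_mono h h').trans (le_of_eq ?_)
    rw [oplus_assoc, oplus_assoc, ← oplus_assoc _ z, oplus_comm _ z, oplus_assoc z]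
  have hAJ : A ⊆ {b : M | ∃ y ∈ A, ∃ n, b ≤ oplus y (nmul n x)} :=
    fun y hy => ⟨y, hy, 0, le_oplus_left _ _⟩
  have hxJ : x ∈ {b : M | ∃ y ∈ A, ∃ n, b ≤ oplus y (nmul n x)} :=
    ⟨⊥, hI.bot_mem, 1, by rw [nmul, nmul, bot_oplus, bot_oplus]⟩
  have huniv : {b : M | ∃ y ∈ A, ∃ n, b ≤ oplus y (nmul n x)} = Set.univ := by
    by_contra hne
    exact hx (hA.eq_of_subset _ hJ hne hAJ ▸ hxJ)
  exact (huniv ▸ Set.mem_univ b : b ∈ {b : M | ∃ y ∈ A, ∃ n, b ≤ oplus y (nmul n x)})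

/-- Under general comparability, every element outside a maximal ideal dominates, up to multiples,
an idempotent outside it. -/
theorem GeneralComparability.exists_idem (hM : GeneralComparability M) {A : Set M}
    (hA : IsMaximalIdeal A) {x : M} (hx : x ∉ A) :
    ∃ e, IsIdem e ∧ e ∉ A ∧ ∃ n, e ≤ nmul n x := by
  have hI := hA.isIdeal
  obtain ⟨b, hb, hxb, hbA⟩ := hI.exists_idem_notMem hA.ne_univ x
  obtain ⟨y, hy, n, hbn⟩ := hA.exists_le_oplus_nmul hx b
  set z := nmul n x
  have hzb : z ≤ b := nmul_le hb hxb n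
  -- Comparability splits `b` into `e`, where `y ≤ z`, and `lam b e`, where `z ≤ y`. As `b ≤ y ⊕ z`,
  -- the second part is below twice `y ⊓ b`, hence in `A`, and the first is below `z ⊕ z = 2n x`.
  obtain ⟨e, he, heb, h1, h2⟩ := hM b (y ⊓ b) z hb inf_le_right hzb
  have hlb := lam_le hb heb
  have hb' : b ≤ oplus (y ⊓ b) z := by
    rw [oplus_comm]
    rw [oplus_comm] at hbn
    exact le_oplus_inf hbn (le_oplus_right _ _)
  have hyb : y ⊓ b ∈ A := hI.mem_of_le _ _ inf_le_left hy
  have hl : lam b e ∈ A := by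
    refine hI.mem_of_le _ _ ?_ (hI.oplus_mem _ _ hyb hyb)
    calc lam b e = lam b e ⊓ b := (inf_eq_left.2 hlb).symm
      _ ≤ lam b e ⊓ oplus (y ⊓ b) z := inf_le_inf_left _ hb'
      _ ≤ oplus (lam b e ⊓ (y ⊓ b)) (lam b e ⊓ z) := inf_oplus_le _ _ _
      _ ≤ oplus (y ⊓ b) (y ⊓ b) := oplus_mono inf_le_right (by rwa [inf_comm])
  refine ⟨e, he, fun heA => hbA ?_, n + n, ?_⟩
  · rw [← oplus_lam hb heb]
    exact hI.oplus_mem _ _ heA hl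
  · rw [nmul_add]
    calc e = e ⊓ b := (inf_eq_left.2 heb).symm
      _ ≤ e ⊓ oplus (y ⊓ b) z := inf_le_inf_left _ hb'
      _ ≤ oplus (e ⊓ (y ⊓ b)) (e ⊓ z) := inf_oplus_le _ _ _
      _ ≤ oplus z z := oplus_mono (by rwa [inf_comm]) inf_le_right

theorem IsIdeal.idem {A : Set M} (hA : IsIdeal A) : IsIdeal {e : Idem M | e.1 ∈ A} :=
  ⟨⟨⊥, hA.bot_mem⟩, fun x y h hy => hA.mem_of_le x.1 y.1 h hy,
    fun x y hx hy => hA.oplus_mem x.1 y.1 hx hy⟩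

/-- Primeness does the work: if an idempotent `e` is outside `A`, its complement in any idempotent
above it is disjoint from `e` and so lies in `A`. -/
theorem IsMaximalIdeal.idem {A : Set M} (hA : IsMaximalIdeal A) :
    IsMaximalIdeal {e : Idem M | e.1 ∈ A} := by
  have hI := hA.isIdeal
  refine ⟨hI.idem, fun h => ?_, fun J hJ hne hAJ => ?_⟩
  · obtain ⟨b, hb, -, hbA⟩ := hI.exists_idem_notMem hA.ne_univ ⊥
    exact hbA (h ▸ Set.mem_univ (⟨b, hb⟩ : Idem M) : (⟨b, hb⟩ : Idem M) ∈ {e : Idem M | e.1 ∈ A})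
  · by_contra hcon
    obtain ⟨e, heJ, heA⟩ := Set.not_subset.1 fun h => hcon (h.antisymm hAJ)
    refine hne (Set.eq_univ_of_forall fun f => ?_)
    let d : Idem M := e ⊔ f
    have hed : e.1 ≤ d.1 := (le_sup_left : e ≤ e ⊔ f)
    have hl : lam d.1 e.1 ∈ A := by
      refine (hA.mem_or_mem ?_).resolve_left heA
      rw [inf_lam_self d.2 e.2 hed]
      exact hI.bot_mem
    have hlJ : (⟨lam d.1 e.1, d.2.lam e.2 hed⟩ : Idem M) ∈ J := hAJ hl
    refine hJ.mem_of_le f d le_sup_right ?_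
    have hd : d = oplus e ⟨lam d.1 e.1, d.2.lam e.2 hed⟩ :=
      Subtype.ext (oplus_lam d.2 hed).symm
    rw [hd]
    exact hJ.oplus_mem _ _ heJ hlJ

namespace MaxI

/-- The contraction `A ↦ A ∩ I(M)` of a maximal ideal to the idempotents. -/
def contract (A : MaxI M) : MaxI (Idem M) := ⟨{e | e.1 ∈ A.1}, A.2.idem⟩

theorem mem_contract {A : MaxI M} {e : Idem M} : e ∈ A.contract.1 ↔ e.1 ∈ A.1 := Iff.rfl

/-- The down-closure of `P` in `M` is an ideal avoiding some idempotent. A maximal ideal above it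
contracts to a proper ideal containing `P`, hence to `P`. -/
theorem contract_surjective : Function.Surjective (contract : MaxI M → MaxI (Idem M)) := by
  intro P
  have hP := P.2.isIdeal
  obtain ⟨c, hc⟩ := (Set.ne_univ_iff_exists_notMem P.1).1 P.2.ne_univ
  have hI : IsIdeal {x : M | ∃ e ∈ P.1, x ≤ e.1} :=
    ⟨⟨⊥, ⊥, hP.bot_mem, bot_le⟩, fun x y hxy ⟨e, he, hy⟩ => ⟨e, he, hxy.trans hy⟩,
      fun x y ⟨e, he, hx⟩ ⟨f, hf, hy⟩ => ⟨oplus e f, hP.oplus_mem _ _ he hf, oplus_mono hx hy⟩⟩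
  obtain ⟨A, hA, hIA, -⟩ := hI.exists_isMaximalIdeal c.2
    fun ⟨e, he, h⟩ => hc (hP.mem_of_le c e h he)
  exact ⟨⟨A, hA⟩, Subtype.ext (P.2.eq_of_subset _ hA.idem.isIdeal hA.idem.ne_univ
    fun e he => hIA ⟨e, he, le_rfl⟩)⟩

theorem contract_injective (hM : GeneralComparability M) :
    Function.Injective (contract : MaxI M → MaxI (Idem M)) := by
  have key : ∀ A B : MaxI M, A.contract = B.contract → A.1 ⊆ B.1 := by
    intro A B h x hxA
    by_contra hxB
    obtain ⟨e, he, heB, n, hn⟩ := hM.exists_idem B.2 hxB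
    refine heB ((mem_contract (e := ⟨e, he⟩)).1 ?_)
    rw [← h]
    exact A.2.isIdeal.mem_of_le _ _ hn (A.2.isIdeal.nmul_mem hxA n)
  exact fun A B h => Subtype.ext ((key A B h).antisymm (key B A h.symm))

theorem continuous_contract : Continuous (contract : MaxI M → MaxI (Idem M)) := by
  refine ⟨?_⟩
  rintro _ ⟨J, -, rfl⟩
  have : contract ⁻¹' {P : MaxI (Idem M) | ¬ J ⊆ P.1} =
      ⋃ e ∈ J, {A : MaxI M | e.1 ∉ A.1} := by
    ext A
    simp [Set.not_subset, mem_contract]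
  rw [this]
  exact isOpen_biUnion fun e _ => isOpen_setOf_notMem e.1

/-- The open set of `I` is sent to the open set of the idempotents of `I`: an element of `I` outside
`A` yields an idempotent of `I` outside `A`. -/
theorem isOpenMap_contract (hM : GeneralComparability M) :
    IsOpenMap (contract : MaxI M → MaxI (Idem M)) := by
  rintro _ ⟨I, hI, rfl⟩
  refine ⟨{e : Idem M | e.1 ∈ I}, hI.idem, ?_⟩
  ext P
  constructor
  · rintro ⟨A, hA, rfl⟩ h
    obtain ⟨x, hxI, hxA⟩ := Set.not_subset.1 hA
    obtain ⟨e, he, heA, n, hn⟩ := hM.exists_idem A.2 hxA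
    exact heA (h (a := ⟨e, he⟩) (hI.mem_of_le _ _ hn (hI.nmul_mem hxI n)))
  · intro h
    obtain ⟨A, rfl⟩ := contract_surjective P
    exact ⟨A, fun hIA => h fun e he => hIA he, rfl⟩

/-- Under general comparability, contraction to the idempotents is a homeomorphism. -/
noncomputable def contractHomeomorph (hM : GeneralComparability M) : MaxI M ≃ₜ MaxI (Idem M) :=
  (Equiv.ofBijective contract
    ⟨contract_injective hM, contract_surjective⟩).toHomeomorphOfContinuousOpen
    continuous_contract (isOpenMap_contract hM)

theorem exists_isTop_of_compactSpace [CompactSpace (MaxI M)] : ∃ t : M, IsTop t := by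
  obtain ⟨⟨a, ha⟩, hcov⟩ := isCompact_univ.elim_directed_cover
    (fun a : Idem M => {A : MaxI M | a.1 ∉ A.1}) (fun a => isOpen_setOf_notMem a.1)
    (fun A _ => by
      obtain ⟨b, hb, -, hbA⟩ := A.2.isIdeal.exists_idem_notMem A.2.ne_univ ⊥
      exact Set.mem_iUnion.2 ⟨⟨b, hb⟩, hbA⟩)
    (fun a b => ⟨a ⊔ b,
      fun A hA h => hA (A.2.isIdeal.mem_of_le _ _ (le_sup_left : a ≤ a ⊔ b) h),
      fun A hA h => hA (A.2.isIdeal.mem_of_le _ _ (le_sup_right : b ≤ a ⊔ b) h)⟩)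
  refine ⟨a, fun x => ?_⟩
  obtain ⟨b, hb, hxb⟩ := exists_idempotent_ge (a ⊔ x)
  have hab : a ≤ b := le_sup_left.trans hxb
  -- By compactness `a` lies in no maximal ideal. Were `lam b a` nonzero, some maximal ideal would
  -- avoid it and so contain `a` by primeness.
  have hl : lam b a = ⊥ := by
    by_contra hne
    have hI : IsIdeal ({⊥} : Set M) := by
      refine ⟨⟨⊥, rfl⟩, ?_, ?_⟩
      · rintro x _ hxy rfl
        exact le_bot_iff.1 hxy
      · rintro _ _ rfl rfl
        exact oplus_bot _
    obtain ⟨A, hA, -, hlA⟩ := hI.exists_isMaximalIdeal (IsIdem.lam hb ha hab) hne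
    have haA : a ∉ A := hcov (Set.mem_univ (⟨A, hA⟩ : MaxI M))
    have := hA.mem_or_mem (inf_lam_self hb ha hab ▸ hA.isIdeal.bot_mem)
    exact this.elim haA hlA
  have := oplus_lam hb hab
  rw [hl, oplus_bot] at this
  rw [this]
  exact le_sup_right.trans hxb

end MaxI

/-- With a top `t`, attaining `1` somewhere becomes the closed condition `s t = 1`, and
state-morphisms form a closed subset of a compact cube. -/
theorem StateMorphism.compactSpace_of_isTop {t : M} (ht : IsTop t) :
    CompactSpace (StateMorphism M) := by
  have hset : {s : M → unitInterval | IsEMVHom s ∧ ∃ x, s x = 1} =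
      {s | (∀ x y, (s (oplus x y)).1 = min ((s x).1 + (s y).1) 1) ∧ (s ⊥).1 = 0 ∧
        (∀ b x, IsIdem b → x ≤ b → (s (lam b x)).1 = (s b).1 - (s x).1) ∧ (s t).1 = 1} := by
    ext s
    constructor
    · intro hs
      let s' : StateMorphism M := ⟨s, hs⟩
      refine ⟨s'.map_oplus, congrArg Subtype.val s'.map_bot, fun b x => s'.map_lam, ?_⟩
      obtain ⟨b, -, -, hb⟩ := s'.exists_idem_ge ⊥
      exact le_antisymm (s t).2.2 (hb.ge.trans (s'.mono (ht b)))
    · rintro ⟨h1, h2, h3, h4⟩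
      exact ⟨isEMVHom_unitInterval_iff.2 ⟨fun x y => Subtype.ext (h1 x y), Subtype.ext h2, h3⟩,
        t, Subtype.ext h4⟩
  have hc : ∀ x, Continuous fun s : M → unitInterval => (s x).1 := fun x =>
    continuous_subtype_val.comp (continuous_apply x)
  have hclosed : IsClosed {s : M → unitInterval | IsEMVHom s ∧ ∃ x, s x = 1} := by
    rw [hset]
    refine IsClosed.and ?_ (IsClosed.and ?_ (IsClosed.and ?_ ?_))
    · simp only [Set.ofPred_forall]
      exact isClosed_iInter fun x => isClosed_iInter fun y =>
        isClosed_eq (hc _) (((hc x).add (hc y)).min continuous_const)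
    · exact isClosed_eq (hc _) continuous_const
    · simp only [Set.ofPred_forall]
      exact isClosed_iInter fun b => isClosed_iInter fun x => isClosed_iInter fun _ =>
        isClosed_iInter fun _ => isClosed_eq (hc _) ((hc b).sub (hc x))
    · exact isClosed_eq (hc _) continuous_const
  exact isCompact_iff_compactSpace.1 hclosed.isCompact

theorem compactSpace_iff_exists_isTop {X : Type*} [TopologicalSpace X] (e : X ≃ₜ MaxI M) :
    CompactSpace X ↔ ∃ t : M, IsTop t := by
  constructor
  · intro _
    have := e.compactSpace
    exact MaxI.exists_isTop_of_compactSpace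
  · rintro ⟨t, ht⟩
    have := StateMorphism.compactSpace_of_isTop ht
    exact ((StateMorphism.kerHomeomorph M).trans e.symm).compactSpace

end Contraction

end EMVAlgebra

theorem mainTheorem7 {M : Type*} [DistribLattice M] [OrderBot M] [EMVAlgebra M]
    (hM : EMVAlgebra.GeneralComparability M) :
    (∃ ξ : EMVAlgebra.MaxI M ≃ₜ EMVAlgebra.MaxI (EMVAlgebra.Idem M),
      ∀ A : EMVAlgebra.MaxI M,
        (ξ A).1 = {e : EMVAlgebra.Idem M | e.1 ∈ A.1}) ∧
    (Nonempty (EMVAlgebra.StateMorphism M ≃ₜ EMVAlgebra.StateMorphism (EMVAlgebra.Idem M)) ∧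
      Nonempty (EMVAlgebra.StateMorphism M ≃ₜ EMVAlgebra.MaxI M) ∧
      Nonempty (EMVAlgebra.StateMorphism M ≃ₜ EMVAlgebra.MaxI (EMVAlgebra.Idem M)) ∧
      Nonempty (EMVAlgebra.StateMorphism (EMVAlgebra.Idem M) ≃ₜ EMVAlgebra.MaxI M) ∧
      Nonempty (EMVAlgebra.StateMorphism (EMVAlgebra.Idem M) ≃ₜ
        EMVAlgebra.MaxI (EMVAlgebra.Idem M)) ∧
      Nonempty (EMVAlgebra.MaxI M ≃ₜ EMVAlgebra.MaxI (EMVAlgebra.Idem M))) ∧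
    ((CompactSpace (EMVAlgebra.StateMorphism M) ↔ ∃ t : M, IsTop t) ∧
      (CompactSpace (EMVAlgebra.StateMorphism (EMVAlgebra.Idem M)) ↔ ∃ t : M, IsTop t) ∧
      (CompactSpace (EMVAlgebra.MaxI M) ↔ ∃ t : M, IsTop t) ∧
      (CompactSpace (EMVAlgebra.MaxI (EMVAlgebra.Idem M)) ↔ ∃ t : M, IsTop t)) := by

  let ξ := EMVAlgebra.MaxI.contractHomeomorph hM
  let k := EMVAlgebra.StateMorphism.kerHomeomorph M
  let k' := EMVAlgebra.StateMorphism.kerHomeomorph (EMVAlgebra.Idem M)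
  exact ⟨⟨ξ, fun _ => rfl⟩,
    ⟨⟨(k.trans ξ).trans k'.symm⟩, ⟨k⟩, ⟨k.trans ξ⟩, ⟨k'.trans ξ.symm⟩, ⟨k'⟩, ⟨ξ⟩⟩,
    EMVAlgebra.compactSpace_iff_exists_isTop k,
    EMVAlgebra.compactSpace_iff_exists_isTop (k'.trans ξ.symm),
    EMVAlgebra.compactSpace_iff_exists_isTop (Homeomorph.refl _),
    EMVAlgebra.compactSpace_iff_exists_isTop ξ.symm⟩
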